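/- Corollary. A commutative residuated lattice is an algebra $\langle A,\vee,\wedge,\cdot,\to,1\rangle$ such that $\langle A,\vee,\wedge\rangle$ is a lattice, $\langle A,\cdot,1\rangle$ is a commutative monoid, and $ab\le c$ iff $a\le b\to c$; it is integral if $1$ is its largest element. Put $\mathord{\sim}x=x\to 1$. A K-lattice is a commutative residuated lattice in which $\mathord{\sim}\mathord{\sim}x=x$, both lattice distributive laws hold whenever one of the elements involved equals $1$, and $$xy\wedge 1=(x\wedge 1)(y\wedge 1),\qquad ((x\wedge 1)\to y)\wedge((\mathord{\sim}y\wedge 1)\to\mathord{\sim}x)=x\to y.$$ Let $\mathsf{GNPcL}$ (Gödel Nelson paraconsistent lattices) be the class of K-lattices that are distributive as lattices and satisfy $(x\wedge1)^2=x\wedge 1$ and $(((x\wedge 1)\to y)\vee((y\wedge 1)\to x))\wedge 1=1$. Let $\mathsf{GH}$ (Gödel hoops) be the class of integral commutative residuated lattices satisfying $x(x\to y)=y(y\to x)$, $xx=x$ and $(x\to y)\vee(y\to x)=1$, and for $n\ge 2$ let $\mathbf G_n\in\mathsf{GH}$ be the $n$-element chain, with least element $0$. For an integral commutative residuated lattice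 $\mathbf L$, let $K(\mathbf L)$ be the algebra on $L\times L$ with unit $(1,1)$ and $$(a,b)\vee(c,d)=(a\vee c,b\wedge d),\qquad (a,b)\wedge(c,d)=(a\wedge c,b\vee d),$$ $$(a,b)(c,d)=(ac,(a\to d)\wedge(c\to b)),\qquad (a,b)\to(c,d)=((a\to c)\wedge(d\to b),ad).$$ For a class $\mathsf V$ of integral commutative residuated lattices, let $K(\mathsf V)$ be the class of K-lattices that embed in $K(\mathbf L)$ for some $\mathbf L\in\mathsf V$. For $n\ge2$ let $\mathbf K_{n^2}=K(\mathbf G_n)$ and let $\mathbf K_{n^2-1}$ be its subalgebra with universe $K(\mathbf G_n)\setminus\{(0,0)\}$. Let $V(\mathbf A)$ denote the variety generated by $\mathbf A$. Then $\mathsf{GNPcL}$ is a variety, $\mathsf{GNPcL}=K(\mathsf{GH})$, and $V(\mathbf K_{n^2})=K(V(\mathbf G_n))$ for all $n\ge 2$. The lattice of subvarieties of $\mathsf{GNPcL}$, ordered by inclusion, is a chain of type $\omega+1$. Its members other than $\mathsf{GNPcL}$ are exactly the trivial variety (of one-element algebras) and the varieties $V(\mathbf K_{n^2})$ and $V(\mathbf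 K_{n^2-1})$ with $n\ge2$. Moreover, for all $u,v$ of the form $n^2$ or $n^2-1$ with $n\ge 2$, $V(\mathbf K_u)\subseteq V(\mathbf K_v)$ if and only if $u\le v$. -/

import Mathlib

universe u v

namespace KLattice

/-! ### Commutative residuated lattices -/

/-- A commutative residuated lattice `⟨A, ⊔, ⊓, *, ⇨, 1⟩`; the residual is written `⇨`. -/
class CRL (A : Type u) extends Lattice A, CommMonoid A, HImp A where
  residuation : ∀ a b c : A, a * b ≤ c ↔ a ≤ b ⇨ c

/-- Integrality: `1` is the largest element. A `CIRL` is a `CRL` that is integral. -/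
class IsIntegral (A : Type u) [CRL A] : Prop where
  le_one : ∀ a : A, a ≤ 1

/-- Homomorphisms of commutative residuated lattices. -/
structure CRLHom (A : Type u) (B : Type v) [CRL A] [CRL B] where
  toFun : A → B
  map_sup : ∀ a b, toFun (a ⊔ b) = toFun a ⊔ toFun b
  map_inf : ∀ a b, toFun (a ⊓ b) = toFun a ⊓ toFun b
  map_mul : ∀ a b, toFun (a * b) = toFun a * toFun b
  map_imp : ∀ a b, toFun (a ⇨ b) = toFun a ⇨ toFun b
  map_one : toFun 1 = 1

/-- Direct products, with componentwise operations. -/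
instance instCRLPi {I : Type v} {A : I → Type u} [∀ i, CRL (A i)] : CRL (∀ i, A i) where
  __ := (inferInstance : Lattice (∀ i, A i))
  __ := (inferInstance : CommMonoid (∀ i, A i))
  himp f g := fun i => f i ⇨ g i
  residuation f g h := by
    constructor
    · exact fun H i => (CRL.residuation _ _ _).1 (H i)
    · exact fun H i => (CRL.residuation _ _ _).2 (H i)

/-- Subuniverses: subsets closed under all the operations. -/
structure IsSubuniverse {A : Type u} [CRL A] (S : Set A) : Prop where
  sup_mem : ∀ {a b}, a ∈ S → b ∈ S → a ⊔ b ∈ S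
  inf_mem : ∀ {a b}, a ∈ S → b ∈ S → a ⊓ b ∈ S
  mul_mem : ∀ {a b}, a ∈ S → b ∈ S → a * b ∈ S
  imp_mem : ∀ {a b}, a ∈ S → b ∈ S → (a ⇨ b) ∈ S
  one_mem : (1 : A) ∈ S

/-- The subalgebra with a given subuniverse, with the restricted operations. -/
abbrev IsSubuniverse.crl {A : Type u} [CRL A] {S : Set A} (h : IsSubuniverse S) : CRL S where
  __ := (Subtype.lattice (P := fun x => x ∈ S) (fun _ _ => h.sup_mem) (fun _ _ => h.inf_mem) :
    Lattice S)
  mul a b := ⟨a.1 * b.1, h.mul_mem a.2 b.2⟩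
  one := ⟨1, h.one_mem⟩
  mul_assoc a b c := Subtype.ext (mul_assoc a.1 b.1 c.1)
  mul_comm a b := Subtype.ext (mul_comm a.1 b.1)
  one_mul a := Subtype.ext (one_mul a.1)
  mul_one a := Subtype.ext (mul_one a.1)
  himp a b := ⟨a.1 ⇨ b.1, h.imp_mem a.2 b.2⟩
  residuation a b c := CRL.residuation a.1 b.1 c.1

/-! ### Classes of algebras and varieties -/

/-- Bundled commutative residuated lattices. -/
structure CRLAlg : Type (u + 1) where
  carrier : Type u
  [str : CRL carrier]

attribute [instance] CRLAlg.str

instance : CoeSort CRLAlg.{u} (Type u) := ⟨CRLAlg.carrier⟩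

/-- A variety: a class of algebras closed under homomorphic images, subalgebras (up to
isomorphism), and direct products. -/
structure IsVariety (V : Set CRLAlg.{u}) : Prop where
  hom_image : ∀ {A B : CRLAlg.{u}} (f : CRLHom A B), Function.Surjective f.toFun → A ∈ V → B ∈ V
  subalgebra : ∀ {A B : CRLAlg.{u}} (f : CRLHom B A), Function.Injective f.toFun → A ∈ V → B ∈ V
  product : ∀ {I : Type u} (A : I → CRLAlg.{u}), (∀ i, A i ∈ V) → CRLAlg.mk (∀ i, A i) ∈ V

/-- The variety generated by a class of algebras: the smallest variety that contains it. -/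
def varietyGen (C : Set CRLAlg.{u}) : Set CRLAlg.{u} :=
  {A | ∀ V : Set CRLAlg.{u}, IsVariety V → C ⊆ V → A ∈ V}

/-- The lattice of subvarieties of `V`, ordered by inclusion. -/
def Subvarieties (V : Set CRLAlg.{u}) : Type (u + 1) :=
  {W : Set CRLAlg.{u} // IsVariety W ∧ W ⊆ V}

instance (V : Set CRLAlg.{u}) : PartialOrder (Subvarieties V) :=
  inferInstanceAs (PartialOrder {W : Set CRLAlg.{u} // IsVariety W ∧ W ⊆ V})

/-- The trivial variety, consisting of the one-element algebras. -/
def trivialVariety : Set CRLAlg.{u} := {A | Subsingleton A}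

/-! ### Gödel hoops -/

/-- The class `GH` of Gödel hoops: integral, divisible, idempotent and prelinear. -/
def GH : Set CRLAlg.{u} :=
  {A | IsIntegral A ∧
    (∀ x y : A, x * (x ⇨ y) = y * (y ⇨ x)) ∧
    (∀ x : A, x * x = x) ∧
    (∀ x y : A, (x ⇨ y) ⊔ (y ⇨ x) = 1)}

/-- The carrier of the `n`-element chain, in an arbitrary universe. -/
@[ext]
structure GodelChain (n : ℕ) : Type u where
  val : Fin n

namespace GodelChain

variable {n : ℕ}

instance : LinearOrder (GodelChain.{u} n) :=
  LinearOrder.lift' GodelChain.val fun _ _ h => GodelChain.ext h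

theorem le_def {a b : GodelChain.{u} n} : a ≤ b ↔ a.val ≤ b.val := Iff.rfl

variable [NeZero n]

instance : BoundedOrder (GodelChain.{u} n) where
  top := ⟨Fin.rev 0⟩
  bot := ⟨0⟩
  le_top a := le_def.2 (by
    rw [Fin.le_def, Fin.val_rev, Fin.val_zero]
    have := a.val.isLt
    omega)
  bot_le a := le_def.2 (Fin.zero_le _)

/-- The `n`-element Gödel chain `G_n` (`n ≥ 1`): the product is the meet, `1` is the top element,
and `a ⇨ b` is `1` if `a ≤ b` and `b` otherwise. -/
instance : CRL (GodelChain.{u} n) where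
  __ := (inferInstance : Lattice (GodelChain.{u} n))
  mul a b := a ⊓ b
  one := ⊤
  mul_assoc := inf_assoc
  mul_comm := inf_comm
  one_mul := top_inf_eq
  mul_one := inf_top_eq
  himp a b := if a ≤ b then ⊤ else b
  residuation a b c := by
    change a ⊓ b ≤ c ↔ a ≤ (if b ≤ c then ⊤ else c)
    split_ifs with h
    · exact ⟨fun _ => le_top, fun _ => inf_le_right.trans h⟩
    · rw [inf_le_iff]
      exact ⟨fun H => H.resolve_right h, Or.inl⟩

instance : IsIntegral (GodelChain.{u} n) := ⟨fun a => (le_top : a ≤ ⊤)⟩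

theorem mul_def (a b : GodelChain.{u} n) : a * b = a ⊓ b := rfl

theorem one_def : (1 : GodelChain.{u} n) = ⊤ := rfl

theorem imp_def (a b : GodelChain.{u} n) : a ⇨ b = if a ≤ b then ⊤ else b := rfl

theorem eq_bot_of_imp_eq_bot [Nontrivial (GodelChain.{u} n)] {a b : GodelChain.{u} n}
    (h : a ⇨ b = ⊥) : b = ⊥ := by
  rw [imp_def] at h
  split_ifs at h with hab
  · exact absurd h top_ne_bot
  · exact h

theorem bot_imp (a : GodelChain.{u} n) : ⊥ ⇨ a = (⊤ : GodelChain.{u} n) := by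
  rw [imp_def, if_pos bot_le]

theorem inf_eq_bot {a b : GodelChain.{u} n} (h : a ⊓ b = ⊥) : a = ⊥ ∨ b = ⊥ := by
  rcases le_total a b with hab | hab
  · left; rwa [inf_eq_left.2 hab] at h
  · right; rwa [inf_eq_right.2 hab] at h

end GodelChain

instance (n : ℕ) : Nontrivial (GodelChain.{u} (n + 2)) :=
  ⟨⟨⟨0⟩, ⟨1⟩, fun h => by simpa using congrArg GodelChain.val h⟩⟩

/-! ### The K-expansion -/

section Arith

variable {A : Type u} [CRL A]

theorem imp_inf (a b c : A) : a ⇨ (b ⊓ c) = (a ⇨ b) ⊓ (a ⇨ c) := by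
  refine eq_of_forall_le_iff fun x => ?_
  simp only [le_inf_iff, ← CRL.residuation]

theorem imp_imp (a b c : A) : a ⇨ (b ⇨ c) = (a * b) ⇨ c := by
  refine eq_of_forall_le_iff fun x => ?_
  simp only [← CRL.residuation, mul_assoc]

theorem one_imp (a : A) : (1 : A) ⇨ a = a := by
  refine eq_of_forall_le_iff fun x => ?_
  rw [← CRL.residuation, mul_one]

theorem imp_one [IsIntegral A] (a : A) : a ⇨ (1 : A) = 1 :=
  le_antisymm (IsIntegral.le_one _) ((CRL.residuation _ _ _).1 (IsIntegral.le_one _))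

end Arith

/-- The universe `L × L` of the K-expansion of `L`. -/
@[ext]
structure KExp (L : Type u) : Type u where
  fst : L
  snd : L

namespace KExp

variable {L : Type u} [CRL L]

instance : Lattice (KExp L) where
  le x y := x.fst ≤ y.fst ∧ y.snd ≤ x.snd
  le_refl x := ⟨le_rfl, le_rfl⟩
  le_trans x y z h h' := ⟨h.1.trans h'.1, h'.2.trans h.2⟩
  le_antisymm x y h h' := KExp.ext (le_antisymm h.1 h'.1) (le_antisymm h'.2 h.2)
  sup x y := ⟨x.fst ⊔ y.fst, x.snd ⊓ y.snd⟩
  inf x y := ⟨x.fst ⊓ y.fst, x.snd ⊔ y.snd⟩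
  le_sup_left x y := ⟨le_sup_left, inf_le_left⟩
  le_sup_right x y := ⟨le_sup_right, inf_le_right⟩
  sup_le x y z h h' := ⟨sup_le h.1 h'.1, le_inf h.2 h'.2⟩
  inf_le_left x y := ⟨inf_le_left, le_sup_left⟩
  inf_le_right x y := ⟨inf_le_right, le_sup_right⟩
  le_inf x y z h h' := ⟨le_inf h.1 h'.1, sup_le h.2 h'.2⟩

variable [IsIntegral L]

/-- The K-expansion `K(L)` of a commutative integral residuated lattice `L`. -/
instance : CRL (KExp L) where
  mul x y := ⟨x.fst * y.fst, (x.fst ⇨ y.snd) ⊓ (y.fst ⇨ x.snd)⟩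
  one := ⟨1, 1⟩
  mul_assoc x y z := by
    refine KExp.ext (mul_assoc _ _ _) ?_
    change ((x.fst * y.fst) ⇨ z.snd) ⊓ (z.fst ⇨ ((x.fst ⇨ y.snd) ⊓ (y.fst ⇨ x.snd))) =
      (x.fst ⇨ ((y.fst ⇨ z.snd) ⊓ (z.fst ⇨ y.snd))) ⊓ ((y.fst * z.fst) ⇨ x.snd)
    rw [imp_inf, imp_inf, imp_imp, imp_imp, imp_imp, imp_imp, mul_comm z.fst x.fst,
      mul_comm z.fst y.fst, inf_assoc]
  mul_comm x y := KExp.ext (mul_comm _ _) (inf_comm _ _)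
  one_mul x := by
    refine KExp.ext (one_mul _) ?_
    change ((1 : L) ⇨ x.snd) ⊓ (x.fst ⇨ (1 : L)) = x.snd
    rw [one_imp, imp_one, inf_eq_left.2 (IsIntegral.le_one _)]
  mul_one x := by
    refine KExp.ext (mul_one _) ?_
    change (x.fst ⇨ (1 : L)) ⊓ ((1 : L) ⇨ x.snd) = x.snd
    rw [one_imp, imp_one, inf_eq_right.2 (IsIntegral.le_one _)]
  himp x y := ⟨(x.fst ⇨ y.fst) ⊓ (y.snd ⇨ x.snd), x.fst * y.snd⟩
  residuation x y z := by
    change (x.fst * y.fst ≤ z.fst ∧ z.snd ≤ (x.fst ⇨ y.snd) ⊓ (y.fst ⇨ x.snd)) ↔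
      (x.fst ≤ (y.fst ⇨ z.fst) ⊓ (z.snd ⇨ y.snd) ∧ y.fst * z.snd ≤ x.snd)
    simp only [le_inf_iff, ← CRL.residuation]
    rw [mul_comm z.snd x.fst, mul_comm z.snd y.fst]
    tauto

end KExp

/-! ### K-lattices and Gödel Nelson paraconsistent lattices -/

/-- K-lattices: commutative residuated lattices that are `1`-involutive, `1`-distributive
(both lattice distributive laws hold when one of the elements is `1`), and satisfy
(K1) and (K2), where `∼x = x ⇨ 1`. -/
structure IsKLattice (A : Type u) [CRL A] : Prop where
  involutive : ∀ x : A, (x ⇨ 1) ⇨ 1 = x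
  inf_sup_of_one : ∀ x y z : A, x = 1 ∨ y = 1 ∨ z = 1 → x ⊓ (y ⊔ z) = (x ⊓ y) ⊔ (x ⊓ z)
  sup_inf_of_one : ∀ x y z : A, x = 1 ∨ y = 1 ∨ z = 1 → x ⊔ (y ⊓ z) = (x ⊔ y) ⊓ (x ⊔ z)
  k1 : ∀ x y : A, (x * y) ⊓ 1 = (x ⊓ 1) * (y ⊓ 1)
  k2 : ∀ x y : A, ((x ⊓ 1) ⇨ y) ⊓ (((y ⇨ 1) ⊓ 1) ⇨ (x ⇨ 1)) = x ⇨ y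

/-- The class `NPcL` of Nelson paraconsistent lattices. -/
def NPcL : Set CRLAlg.{u} :=
  {A | IsKLattice A ∧
    (∀ x y z : A, x ⊓ (y ⊔ z) = (x ⊓ y) ⊔ (x ⊓ z)) ∧
    (∀ x : A, (x ⊓ 1) * (x ⊓ 1) = x ⊓ 1)}

/-- The class `GNPcL` of Gödel Nelson paraconsistent lattices. -/
def GNPcL : Set CRLAlg.{u} :=
  {A | A ∈ NPcL ∧ ∀ x y : A, (((x ⊓ 1) ⇨ y) ⊔ ((y ⊓ 1) ⇨ x)) ⊓ 1 = 1}

/-- `K(V)`: the K-lattices that embed into `K(L)` for some integral `L` in `V`. -/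
def KClass (V : Set CRLAlg.{u}) : Set CRLAlg.{u} :=
  {A | IsKLattice A ∧ ∃ L ∈ V, ∃ _ : IsIntegral L, ∃ f : CRLHom A (KExp L),
    Function.Injective f.toFun}

/-! ### The algebras `K_{n²}` and `K_{n²-1}` -/

/-- The Gödel chain `G_n` as an algebra. -/
def algG (n : ℕ) [NeZero n] : CRLAlg.{u} := ⟨GodelChain.{u} n⟩

/-- `K_{n²} = K(G_n)`. -/
def algKSq (n : ℕ) [NeZero n] : CRLAlg.{u} := ⟨KExp (GodelChain.{u} n)⟩

/-- The subset `K(G_n) \ {(0,0)}`, `0` being the least element of `G_n`. -/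
def puncture (n : ℕ) [NeZero n] : Set (KExp (GodelChain.{u} n)) := {x | x ≠ ⟨⊥, ⊥⟩}

theorem puncture_isSubuniverse (n : ℕ) : IsSubuniverse (puncture.{u} (n + 2)) where
  sup_mem {x y} hx hy h := by
    have h1 : x.fst ⊔ y.fst = ⊥ := congrArg KExp.fst h
    have h2 : x.snd ⊓ y.snd = ⊥ := congrArg KExp.snd h
    rw [sup_eq_bot_iff] at h1
    rcases GodelChain.inf_eq_bot h2 with h2 | h2
    · exact hx (KExp.ext h1.1 h2)
    · exact hy (KExp.ext h1.2 h2)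
  inf_mem {x y} hx hy h := by
    have h1 : x.fst ⊓ y.fst = ⊥ := congrArg KExp.fst h
    have h2 : x.snd ⊔ y.snd = ⊥ := congrArg KExp.snd h
    rw [sup_eq_bot_iff] at h2
    rcases GodelChain.inf_eq_bot h1 with h1 | h1
    · exact hx (KExp.ext h1 h2.1)
    · exact hy (KExp.ext h1 h2.2)
  mul_mem {x y} hx hy h := by
    have h1 : x.fst ⊓ y.fst = ⊥ := congrArg KExp.fst h
    have h2 : (x.fst ⇨ y.snd) ⊓ (y.fst ⇨ x.snd) = ⊥ := congrArg KExp.snd h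
    rcases GodelChain.inf_eq_bot h1 with h1 | h1
    · rw [h1, GodelChain.bot_imp, top_inf_eq] at h2
      exact hx (KExp.ext h1 (GodelChain.eq_bot_of_imp_eq_bot h2))
    · rw [h1, GodelChain.bot_imp, inf_top_eq] at h2
      exact hy (KExp.ext h1 (GodelChain.eq_bot_of_imp_eq_bot h2))
  imp_mem {x y} hx hy h := by
    have h1 : (x.fst ⇨ y.fst) ⊓ (y.snd ⇨ x.snd) = ⊥ := congrArg KExp.fst h
    have h2 : x.fst ⊓ y.snd = ⊥ := congrArg KExp.snd h
    rcases GodelChain.inf_eq_bot h2 with h2 | h2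
    · rw [h2, GodelChain.bot_imp, top_inf_eq] at h1
      exact hx (KExp.ext h2 (GodelChain.eq_bot_of_imp_eq_bot h1))
    · rw [h2, GodelChain.bot_imp, inf_top_eq] at h1
      exact hy (KExp.ext (GodelChain.eq_bot_of_imp_eq_bot h1) h2)
  one_mem h := top_ne_bot (congrArg KExp.fst h : (⊤ : GodelChain.{u} (n + 2)) = ⊥)

/-- `K_{n²-1}`, the subalgebra of `K_{n²}` with universe `K(G_n) \ {(0,0)}`; here `n = m + 2`. -/
def algKSqPred (m : ℕ) : CRLAlg.{u} :=
  @CRLAlg.mk (puncture.{u} (m + 2)) (puncture_isSubuniverse m).crl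

/-- `IsK k A` says that `A` is the algebra `K_k`, where `k = n²` or `k = n² - 1` with
`n = m + 2 ≥ 2`. -/
inductive IsK : ℕ → CRLAlg.{u} → Prop
  | sq (m : ℕ) : IsK ((m + 2) ^ 2) (algKSq (m + 2))
  | sqPred (m : ℕ) : IsK ((m + 2) ^ 2 - 1) (algKSqPred m)

end KLattice

open KLattice

-- A K-lattice is recovered from its negative cone: `x` is determined by the pair `x ∧ 1`, `∼x ∧ 1`,
-- and the K-lattice axioms say exactly that this pairing embeds `A` into `K` of the cone
-- (`IsKLattice.embed`). The cone of an algebra in `GNPcL` is a Gödel hoop, which gives `GNPcL =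
-- K(GH)`. Both the cone and `K` preserve surjections, injections and products up to embedding, so
-- they pull varieties back to varieties (`isVariety_negCone`, `isVariety_kExp`); hence `V(K(L)) =
-- K(V(L))`.
--
-- For the subvarieties, prime filters separate the points of a Gödel hoop by maps onto chains, so
-- the points of `A` in `GNPcL` are separated by maps to various `K(C)`, with `C` a chain and all
-- `(c, 1)` in the image. Such an image contains every point of `K(C)` except possibly `(e, e)` with
-- `e` least (`IsSubuniverse.mem_of_negCone`). Thus only the size of `C` and the presence of `(e,
-- e)` matter, and these are what the list `K₃, K₄, K₈, K₉, …` measures. Each member of the list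
-- embeds in the next. A subvariety that misses one of them lies in the variety generated by the
-- preceding one, or is trivial if `K₃` is missed (`subset_kVariety`). A subvariety that contains
-- them all is `GNPcL`, because a finite part of `K(C)` lies in `K` of a finite subchain. Explicit
-- identities (`Term.separator`) show that the chain is strict.

universe w

namespace KLattice

/-! ### Homomorphisms and varieties -/

namespace CRLHom

variable {A : Type u} {B : Type v} {C : Type w} [CRL A] [CRL B] [CRL C]

/-- Composition of homomorphisms. -/
def comp (g : CRLHom B C) (f : CRLHom A B) : CRLHom A C where
  toFun x := g.toFun (f.toFun x)
  map_sup a b := by rw [f.map_sup, g.map_sup]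
  map_inf a b := by rw [f.map_inf, g.map_inf]
  map_mul a b := by rw [f.map_mul, g.map_mul]
  map_imp a b := by rw [f.map_imp, g.map_imp]
  map_one := by rw [f.map_one, g.map_one]

theorem monotone (f : CRLHom A B) : Monotone f.toFun := fun a b h => by
  rw [← sup_eq_right] at h ⊢
  rw [← f.map_sup, h]

theorem isSubuniverse_range (f : CRLHom A B) : IsSubuniverse (Set.range f.toFun) where
  sup_mem := by
    rintro _ _ ⟨a, rfl⟩ ⟨b, rfl⟩
    exact ⟨_, f.map_sup a b⟩
  inf_mem := by
    rintro _ _ ⟨a, rfl⟩ ⟨b, rfl⟩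
    exact ⟨_, f.map_inf a b⟩
  mul_mem := by
    rintro _ _ ⟨a, rfl⟩ ⟨b, rfl⟩
    exact ⟨_, f.map_mul a b⟩
  imp_mem := by
    rintro _ _ ⟨a, rfl⟩ ⟨b, rfl⟩
    exact ⟨_, f.map_imp a b⟩
  one_mem := ⟨1, f.map_one⟩

end CRLHom

/-- The inclusion of a subalgebra. -/
def IsSubuniverse.incl {A : Type u} [CRL A] {S : Set A} (h : IsSubuniverse S) :
    @CRLHom S A h.crl _ :=
  letI := h.crl
  { toFun := Subtype.val
    map_sup := fun _ _ => rfl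
    map_inf := fun _ _ => rfl
    map_mul := fun _ _ => rfl
    map_imp := fun _ _ => rfl
    map_one := rfl }

/-- A homomorphism whose values lie in a subuniverse, as a homomorphism to the subalgebra. -/
def IsSubuniverse.codRestrict {A : Type u} {B : Type v} [CRL A] [CRL B] {S : Set A}
    (h : IsSubuniverse S) (f : CRLHom B A) (hf : ∀ b, f.toFun b ∈ S) : @CRLHom B S _ h.crl :=
  letI := h.crl
  { toFun := fun b => ⟨f.toFun b, hf b⟩
    map_sup := fun _ _ => Subtype.ext (f.map_sup _ _)
    map_inf := fun _ _ => Subtype.ext (f.map_inf _ _)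
    map_mul := fun _ _ => Subtype.ext (f.map_mul _ _)
    map_imp := fun _ _ => Subtype.ext (f.map_imp _ _)
    map_one := Subtype.ext f.map_one }

namespace IsVariety

variable {V : Set CRLAlg.{u}} {A B D : Type u} [CRL A] [CRL B] [CRL D]

theorem of_surjective (hV : IsVariety V) (f : CRLHom A B) (hf : Function.Surjective f.toFun)
    (hA : CRLAlg.mk A ∈ V) : CRLAlg.mk B ∈ V :=
  hV.hom_image (A := ⟨A⟩) (B := ⟨B⟩) f hf hA

theorem of_injective (hV : IsVariety V) (f : CRLHom B A) (hf : Function.Injective f.toFun)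
    (hA : CRLAlg.mk A ∈ V) : CRLAlg.mk B ∈ V :=
  hV.subalgebra (A := ⟨A⟩) (B := ⟨B⟩) f hf hA

/-- An algebra that embeds into a homomorphic image of a member of a variety is a member. -/
theorem of_range (hV : IsVariety V) (hA : CRLAlg.mk A ∈ V) (g : CRLHom A D) (h : CRLHom B D)
    (hi : Function.Injective h.toFun) (hr : Set.range h.toFun ⊆ Set.range g.toFun) :
    CRLAlg.mk B ∈ V := by
  -- The range of `g` is a quotient of `A`, and `h` embeds `B` into it.
  have hs := g.isSubuniverse_range
  let := hs.crl
  have h1 : CRLAlg.mk (Set.range g.toFun) ∈ V :=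
    hV.of_surjective (hs.codRestrict g fun a => ⟨a, rfl⟩)
      (by rintro ⟨_, a, rfl⟩; exact ⟨a, rfl⟩) hA
  exact hV.of_injective (hs.codRestrict h fun b => hr ⟨b, rfl⟩)
    (fun a b hab => hi (congrArg Subtype.val hab)) h1

/-- An algebra whose points are separated by homomorphisms to members of a variety is a member. -/
theorem of_separating (hV : IsVariety V)
    (h : ∀ x y : A, x ≠ y → ∃ B ∈ V, ∃ g : CRLHom A B, g.toFun x ≠ g.toFun y) :
    CRLAlg.mk A ∈ V := by
  choose B hB g hg using h
  let I := {p : A × A // p.1 ≠ p.2}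
  have hP := hV.product (I := I) (fun p => B p.1.1 p.1.2 p.2) fun p => hB _ _ _
  let φ : CRLHom A (∀ p : I, B p.1.1 p.1.2 p.2) :=
    { toFun := fun a p => (g p.1.1 p.1.2 p.2).toFun a
      map_sup := fun _ _ => funext fun _ => CRLHom.map_sup _ _ _
      map_inf := fun _ _ => funext fun _ => CRLHom.map_inf _ _ _
      map_mul := fun _ _ => funext fun _ => CRLHom.map_mul _ _ _
      map_imp := fun _ _ => funext fun _ => CRLHom.map_imp _ _ _
      map_one := funext fun _ => CRLHom.map_one _ }
  refine hV.of_injective φ (fun x y hxy => ?_) hP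
  by_contra hne
  exact hg x y hne (congrFun hxy ⟨(x, y), hne⟩)

/-- An algebra each of whose finite subsets is covered by a homomorphism from a member of a
variety is itself a member. -/
theorem of_local (hV : IsVariety V)
    (h : ∀ T : Finset A, ∃ B ∈ V, ∃ g : CRLHom B A, ↑T ⊆ Set.range g.toFun) :
    CRLAlg.mk A ∈ V := by
  classical
  choose B hB g hg using h
  have hP := hV.product B hB
  -- Limits along the directed set of finite subsets: the image of `x` is eventually constant with
  -- value `a`.
  let Lim (x : ∀ T, B T) (a : A) : Prop := ∃ T₀, ∀ T, T₀ ⊆ T → (g T).toFun (x T) = a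
  have two {x y : ∀ T, B T} {a b : A} (hx : Lim x a) (hy : Lim y b) :
      ∃ T₀, ∀ T, T₀ ⊆ T → (g T).toFun (x T) = a ∧ (g T).toFun (y T) = b := by
    obtain ⟨S, hS⟩ := hx
    obtain ⟨T, hT⟩ := hy
    exact ⟨S ∪ T, fun U hU => ⟨hS U (Finset.union_subset_left hU),
      hT U (Finset.union_subset_right hU)⟩⟩
  have uniq {x : ∀ T, B T} {a b : A} (ha : Lim x a) (hb : Lim x b) : a = b := by
    obtain ⟨T, hT⟩ := two ha hb
    rw [← (hT T subset_rfl).1, ← (hT T subset_rfl).2]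
  have l_sup {x y : ∀ T, B T} {a b : A} (hx : Lim x a) (hy : Lim y b) : Lim (x ⊔ y) (a ⊔ b) := by
    obtain ⟨T, hT⟩ := two hx hy
    refine ⟨T, fun U hU => ?_⟩
    rw [← (hT U hU).1, ← (hT U hU).2, ← (g U).map_sup]; rfl
  have l_inf {x y : ∀ T, B T} {a b : A} (hx : Lim x a) (hy : Lim y b) : Lim (x ⊓ y) (a ⊓ b) := by
    obtain ⟨T, hT⟩ := two hx hy
    refine ⟨T, fun U hU => ?_⟩
    rw [← (hT U hU).1, ← (hT U hU).2, ← (g U).map_inf]; rfl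
  have l_mul {x y : ∀ T, B T} {a b : A} (hx : Lim x a) (hy : Lim y b) : Lim (x * y) (a * b) := by
    obtain ⟨T, hT⟩ := two hx hy
    refine ⟨T, fun U hU => ?_⟩
    rw [← (hT U hU).1, ← (hT U hU).2, ← (g U).map_mul]; rfl
  have l_imp {x y : ∀ T, B T} {a b : A} (hx : Lim x a) (hy : Lim y b) : Lim (x ⇨ y) (a ⇨ b) := by
    obtain ⟨T, hT⟩ := two hx hy
    refine ⟨T, fun U hU => ?_⟩
    rw [← (hT U hU).1, ← (hT U hU).2, ← (g U).map_imp]; rfl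
  have l_one : Lim 1 1 := ⟨∅, fun U _ => (g U).map_one⟩
  -- The convergent families form a subalgebra of the product, and taking limits maps it
  -- homomorphically onto `A`.
  have hS : IsSubuniverse {x : ∀ T, B T | ∃ a, Lim x a} :=
    { sup_mem := fun ⟨_, ha⟩ ⟨_, hb⟩ => ⟨_, l_sup ha hb⟩
      inf_mem := fun ⟨_, ha⟩ ⟨_, hb⟩ => ⟨_, l_inf ha hb⟩
      mul_mem := fun ⟨_, ha⟩ ⟨_, hb⟩ => ⟨_, l_mul ha hb⟩
      imp_mem := fun ⟨_, ha⟩ ⟨_, hb⟩ => ⟨_, l_imp ha hb⟩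
      one_mem := ⟨1, l_one⟩ }
  let := hS.crl
  have hSV : CRLAlg.mk {x : ∀ T, B T | ∃ a, Lim x a} ∈ V :=
    hV.of_injective hS.incl Subtype.val_injective hP
  let φ : CRLHom {x : ∀ T, B T | ∃ a, Lim x a} A :=
    { toFun := fun x => x.2.choose
      map_sup := fun x y => uniq (Exists.choose_spec _) (l_sup x.2.choose_spec y.2.choose_spec)
      map_inf := fun x y => uniq (Exists.choose_spec _) (l_inf x.2.choose_spec y.2.choose_spec)
      map_mul := fun x y => uniq (Exists.choose_spec _) (l_mul x.2.choose_spec y.2.choose_spec)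
      map_imp := fun x y => uniq (Exists.choose_spec _) (l_imp x.2.choose_spec y.2.choose_spec)
      map_one := uniq (Exists.choose_spec _) l_one }
  refine hV.of_surjective φ (fun a => ?_) hSV
  have : ∀ T : Finset A, ∃ b : B T, a ∈ T → (g T).toFun b = a := fun T => by
    by_cases ha : a ∈ T
    · obtain ⟨b, hb⟩ := hg T ha
      exact ⟨b, fun _ => hb⟩
    -- Any value would do here: only the sets `T` containing `a` affect the limit.
    · exact ⟨1, fun h => absurd h ha⟩
  choose x hx using this
  have hxa : Lim x a := ⟨{a}, fun T hT => hx T (hT (Finset.mem_singleton_self a))⟩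
  exact ⟨⟨x, a, hxa⟩, uniq (Exists.choose_spec _) hxa⟩

theorem inter (hV : IsVariety V) {W : Set CRLAlg.{u}} (hW : IsVariety W) : IsVariety (V ∩ W) where
  hom_image f hf h := ⟨hV.hom_image f hf h.1, hW.hom_image f hf h.2⟩
  subalgebra f hf h := ⟨hV.subalgebra f hf h.1, hW.subalgebra f hf h.2⟩
  product A h := ⟨hV.product A fun i => (h i).1, hW.product A fun i => (h i).2⟩

end IsVariety

theorem isVariety_varietyGen (C : Set CRLAlg.{u}) : IsVariety (varietyGen C) where
  hom_image f hf h V hV hC := hV.hom_image f hf (h V hV hC)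
  subalgebra f hf h V hV hC := hV.subalgebra f hf (h V hV hC)
  product A h V hV hC := hV.product A fun i => h i V hV hC

theorem subset_varietyGen (C : Set CRLAlg.{u}) : C ⊆ varietyGen C := fun _ hA _ _ hC => hC hA

theorem varietyGen_subset {C V : Set CRLAlg.{u}} (hV : IsVariety V) (hC : C ⊆ V) :
    varietyGen C ⊆ V := fun _ hA => hA V hV hC

theorem varietyGen_singleton_subset_iff {A : CRLAlg.{u}} {V : Set CRLAlg.{u}} (hV : IsVariety V) :
    varietyGen {A} ⊆ V ↔ A ∈ V :=
  ⟨fun h => h (subset_varietyGen _ rfl),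
    fun h => varietyGen_subset hV (Set.singleton_subset_iff.2 h)⟩

theorem isVariety_trivialVariety : IsVariety trivialVariety.{u} where
  hom_image _ hf (_ : Subsingleton _) := hf.subsingleton
  subalgebra _ hf (_ : Subsingleton _) := hf.subsingleton
  product A (_ : ∀ i, Subsingleton (A i)) := (inferInstance : Subsingleton (∀ i, A i))

theorem IsVariety.of_subsingleton {V : Set CRLAlg.{u}} (hV : IsVariety V) {A : Type u} [CRL A]
    [Subsingleton A] : CRLAlg.mk A ∈ V :=
  hV.of_separating fun x y h => absurd (Subsingleton.elim x y) h

/-! ### Identities -/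

/-- Terms in the language of commutative residuated lattices. -/
inductive Term : Type
  | var : ℕ → Term
  | sup : Term → Term → Term
  | inf : Term → Term → Term
  | mul : Term → Term → Term
  | imp : Term → Term → Term
  | one : Term

/-- The value of a term under an assignment. -/
def Term.eval {A : Type u} [CRL A] (v : ℕ → A) : Term → A
  | var n => v n
  | sup s t => s.eval v ⊔ t.eval v
  | inf s t => s.eval v ⊓ t.eval v
  | mul s t => s.eval v * t.eval v
  | imp s t => s.eval v ⇨ t.eval v
  | one => 1

theorem CRLHom.map_eval {A : Type u} {B : Type v} [CRL A] [CRL B] (f : CRLHom A B) (a : ℕ → A)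
    (t : Term) : f.toFun (t.eval a) = t.eval fun n => f.toFun (a n) := by
  induction t with
  | var n => rfl
  | sup s t hs ht => simp only [Term.eval, f.map_sup, hs, ht]
  | inf s t hs ht => simp only [Term.eval, f.map_inf, hs, ht]
  | mul s t hs ht => simp only [Term.eval, f.map_mul, hs, ht]
  | imp s t hs ht => simp only [Term.eval, f.map_imp, hs, ht]
  | one => exact f.map_one

theorem Term.eval_pi {I : Type v} {A : I → Type u} [∀ i, CRL (A i)] (a : ℕ → ∀ i, A i) (t : Term)
    (i : I) : t.eval a i = t.eval fun n => a n i :=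
  CRLHom.map_eval (A := ∀ i, A i) (B := A i)
    ⟨fun x => x i, fun _ _ => rfl, fun _ _ => rfl, fun _ _ => rfl, fun _ _ => rfl, rfl⟩ a t

/-- The class of models of a set of identities. -/
def models (E : Set (Term × Term)) : Set CRLAlg.{u} :=
  {A | ∀ e ∈ E, ∀ v : ℕ → A, e.1.eval v = e.2.eval v}

theorem isVariety_models (E : Set (Term × Term)) : IsVariety (models.{u} E) where
  hom_image {A B} f hf h e he v := by
    obtain ⟨w, rfl⟩ : ∃ w : ℕ → A, v = fun n => f.toFun (w n) :=
      ⟨fun n => (hf (v n)).choose, funext fun n => (hf (v n)).choose_spec.symm⟩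
    rw [← f.map_eval, ← f.map_eval, h e he]
  subalgebra {A B} f hf h e he v := hf (by rw [f.map_eval, f.map_eval, h e he])
  product A h e he v := funext fun i => by
    rw [Term.eval_pi (A := fun i => A i), Term.eval_pi (A := fun i => A i), h i e he]


/-! ### K-lattices and Gödel Nelson paraconsistent lattices form varieties -/

/-- An assignment with prescribed values at the first three variables. -/
def assign {A : Type u} (x y z : A) : ℕ → A
  | 0 => x
  | 1 => y
  | _ => z

namespace Term

/-- The distributive law for meets over joins. -/
def infSup (x y z : Term) : Term × Term := (inf x (sup y z), sup (inf x y) (inf x z))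

/-- The distributive law for joins over meets. -/
def supInf (x y z : Term) : Term × Term := (sup x (inf y z), inf (sup x y) (sup x z))

/-- The identities that define K-lattices. -/
def kLatticeIds : Set (Term × Term) :=
  {(imp (imp (var 0) one) one, var 0),
    infSup one (var 1) (var 2), infSup (var 0) one (var 2), infSup (var 0) (var 1) one,
    supInf one (var 1) (var 2), supInf (var 0) one (var 2), supInf (var 0) (var 1) one,
    (inf (mul (var 0) (var 1)) one, mul (inf (var 0) one) (inf (var 1) one)),
    (inf (imp (inf (var 0) one) (var 1)) (imp (inf (imp (var 1) one) one) (imp (var 0) one)),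
      imp (var 0) (var 1))}

/-- The identities that define `GNPcL` within K-lattices. -/
def gnpIds : Set (Term × Term) :=
  {infSup (var 0) (var 1) (var 2),
    (mul (inf (var 0) one) (inf (var 0) one), inf (var 0) one),
    (inf (sup (imp (inf (var 0) one) (var 1)) (imp (inf (var 1) one) (var 0))) one, one)}

end Term

theorem mem_models_kLatticeIds {A : CRLAlg.{u}} :
    A ∈ models Term.kLatticeIds ↔ IsKLattice A := by
  simp only [models, Term.kLatticeIds, Set.mem_ofPred_eq, Set.mem_insert_iff,
    Set.mem_singleton_iff, forall_eq_or_imp, forall_eq, Term.infSup, Term.supInf, Term.eval]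
  constructor
  · rintro ⟨h1, h2, h3, h4, h5, h6, h7, h8, h9⟩
    refine ⟨fun x => h1 (assign x x x), ?_, ?_, fun x y => h8 (assign x y y),
      fun x y => h9 (assign x y y)⟩
    · rintro x y z (rfl | rfl | rfl)
      · exact h2 (assign 1 y z)
      · exact h3 (assign x 1 z)
      · exact h4 (assign x y 1)
    · rintro x y z (rfl | rfl | rfl)
      · exact h5 (assign 1 y z)
      · exact h6 (assign x 1 z)
      · exact h7 (assign x y 1)
  · intro h
    exact ⟨fun v => h.involutive _, fun v => h.inf_sup_of_one _ _ _ (by simp),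
      fun v => h.inf_sup_of_one _ _ _ (by simp), fun v => h.inf_sup_of_one _ _ _ (by simp),
      fun v => h.sup_inf_of_one _ _ _ (by simp), fun v => h.sup_inf_of_one _ _ _ (by simp),
      fun v => h.sup_inf_of_one _ _ _ (by simp), fun v => h.k1 _ _, fun v => h.k2 _ _⟩

theorem GNPcL_eq_models : GNPcL.{u} = models Term.kLatticeIds ∩ models Term.gnpIds := by
  ext A
  simp only [Set.mem_inter_iff, mem_models_kLatticeIds, GNPcL, NPcL, Set.mem_ofPred_eq, and_assoc]
  refine and_congr_right fun _ => ?_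
  simp only [models, Term.gnpIds, Set.mem_ofPred_eq, Set.mem_insert_iff,
    Set.mem_singleton_iff, forall_eq_or_imp, forall_eq, Term.infSup, Term.eval]
  constructor
  · rintro ⟨h1, h2, h3⟩
    exact ⟨fun v => h1 _ _ _, fun v => h2 _, fun v => h3 _ _⟩
  · rintro ⟨h1, h2, h3⟩
    exact ⟨fun x y z => h1 (assign x y z), fun x => h2 (assign x x x),
      fun x y => h3 (assign x y y)⟩

theorem isVariety_setOf_isKLattice : IsVariety {A : CRLAlg.{u} | IsKLattice A} := by
  convert isVariety_models Term.kLatticeIds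
  ext A
  exact mem_models_kLatticeIds.symm

theorem isVariety_GNPcL : IsVariety GNPcL.{u} := by
  rw [GNPcL_eq_models]
  exact (isVariety_models _).inter (isVariety_models _)

/-! ### Arithmetic of commutative residuated lattices -/

namespace CRL

variable {A : Type u} [CRL A] {a b c : A}

theorem imp_mul_le (a b : A) : (a ⇨ b) * a ≤ b := (residuation _ _ _).2 le_rfl

theorem mul_le_mul_right (h : a ≤ b) (c : A) : a * c ≤ b * c :=
  (residuation _ _ _).2 (h.trans ((residuation _ _ _).1 le_rfl))

theorem mul_le_mul {d : A} (h : a ≤ b) (h' : c ≤ d) : a * c ≤ b * d := by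
  refine (mul_le_mul_right h c).trans ?_
  rw [mul_comm b, mul_comm b]
  exact mul_le_mul_right h' b

theorem sup_imp (a b c : A) : (a ⊔ b) ⇨ c = (a ⇨ c) ⊓ (b ⇨ c) := by
  refine eq_of_forall_le_iff fun x => ?_
  simp only [le_inf_iff, ← residuation, mul_comm x]
  simp only [residuation, sup_le_iff]

theorem one_le_imp_iff : 1 ≤ a ⇨ b ↔ a ≤ b := by rw [← residuation, one_mul]

theorem imp_eq_one_iff [IsIntegral A] : a ⇨ b = 1 ↔ a ≤ b := by
  rw [← one_le_imp_iff]
  exact ⟨fun h => h.ge, fun h => le_antisymm (IsIntegral.le_one _) h⟩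

/-- Integrality puts products below both factors; conversely `a ⊓ b` is its own square, which lies
below `a * b`. -/
theorem mul_eq_inf [IsIntegral A] (h : ∀ x : A, x * x = x) (a b : A) : a * b = a ⊓ b := by
  refine le_antisymm (le_inf ?_ ?_) ?_
  · simpa using mul_le_mul (le_refl a) (IsIntegral.le_one b)
  · simpa using mul_le_mul (IsIntegral.le_one a) (le_refl b)
  · rw [← h (a ⊓ b)]
    exact mul_le_mul inf_le_left inf_le_right

/-- Meet is multiplication, hence has the residual as right adjoint and preserves joins. -/
theorem inf_sup_of_idem [IsIntegral A] (h : ∀ x : A, x * x = x) (a b c : A) :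
    a ⊓ (b ⊔ c) = (a ⊓ b) ⊔ (a ⊓ c) := by
  refine le_antisymm ?_ le_inf_sup
  rw [inf_comm, ← mul_eq_inf h, residuation, sup_le_iff, ← residuation, ← residuation,
    mul_eq_inf h, mul_eq_inf h, inf_comm b, inf_comm c]
  exact ⟨le_sup_left, le_sup_right⟩

end CRL

/-! ### The negative cone -/

/-- The negative cone of a commutative residuated lattice. -/
@[ext]
structure NegCone (A : Type u) [CRL A] : Type u where
  val : A
  le_one : val ≤ 1

namespace NegCone

variable {A : Type u} {B : Type v} [CRL A] [CRL B]

instance : CRL (NegCone A) where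
  le a b := a.val ≤ b.val
  le_refl a := le_refl a.val
  le_trans a b c h h' := h.trans h'
  le_antisymm a b h h' := NegCone.ext (le_antisymm h h')
  sup a b := ⟨a.val ⊔ b.val, sup_le a.le_one b.le_one⟩
  inf a b := ⟨a.val ⊓ b.val, inf_le_of_left_le a.le_one⟩
  le_sup_left a b := le_sup_left (a := a.val)
  le_sup_right a b := le_sup_right (a := a.val)
  sup_le a b c h h' := sup_le (α := A) h h'
  inf_le_left a b := inf_le_left (a := a.val)
  inf_le_right a b := inf_le_right (a := a.val)
  le_inf a b c h h' := le_inf (α := A) h h'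
  mul a b := ⟨a.val * b.val, by simpa using CRL.mul_le_mul a.le_one b.le_one⟩
  one := ⟨1, le_rfl⟩
  mul_assoc a b c := NegCone.ext (mul_assoc a.val b.val c.val)
  mul_comm a b := NegCone.ext (mul_comm a.val b.val)
  one_mul a := NegCone.ext (one_mul a.val)
  mul_one a := NegCone.ext (mul_one a.val)
  himp a b := ⟨(a.val ⇨ b.val) ⊓ 1, inf_le_right⟩
  residuation a b c := by
    change a.val * b.val ≤ c.val ↔ a.val ≤ (b.val ⇨ c.val) ⊓ 1
    rw [CRL.residuation, le_inf_iff, and_iff_left a.le_one]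

instance : IsIntegral (NegCone A) := ⟨fun a => a.le_one⟩

/-- The negative part of an element. -/
def neg (x : A) : NegCone A := ⟨x ⊓ 1, inf_le_right⟩

@[simp] theorem val_neg (x : A) : (neg x).val = x ⊓ 1 := rfl
@[simp] theorem val_sup (a b : NegCone A) : (a ⊔ b).val = a.val ⊔ b.val := rfl
@[simp] theorem val_inf (a b : NegCone A) : (a ⊓ b).val = a.val ⊓ b.val := rfl
@[simp] theorem val_mul (a b : NegCone A) : (a * b).val = a.val * b.val := rfl
@[simp] theorem val_imp (a b : NegCone A) : (a ⇨ b).val = (a.val ⇨ b.val) ⊓ 1 := rfl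
@[simp] theorem val_one : (1 : NegCone A).val = 1 := rfl

/-- The action of a homomorphism on negative cones. -/
def map (f : CRLHom A B) : CRLHom (NegCone A) (NegCone B) where
  toFun a := ⟨f.toFun a.val, (f.monotone a.le_one).trans_eq f.map_one⟩
  map_sup a b := NegCone.ext (f.map_sup _ _)
  map_inf a b := NegCone.ext (f.map_inf _ _)
  map_mul a b := NegCone.ext (f.map_mul _ _)
  map_imp a b := NegCone.ext (by simp [f.map_inf, f.map_imp, f.map_one])
  map_one := NegCone.ext f.map_one

theorem map_injective (f : CRLHom A B) (hf : Function.Injective f.toFun) :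
    Function.Injective (map f).toFun := fun _ _ h => NegCone.ext (hf (congrArg NegCone.val h))

theorem map_surjective (f : CRLHom A B) (hf : Function.Surjective f.toFun) :
    Function.Surjective (map f).toFun := by
  rintro ⟨b, hb⟩
  obtain ⟨a, rfl⟩ := hf b
  refine ⟨neg a, NegCone.ext ?_⟩
  change f.toFun (a ⊓ 1) = _
  rw [f.map_inf, f.map_one, inf_eq_left.2 hb]

end NegCone

/-- The algebras whose negative cone lies in a given variety form a variety. -/
theorem isVariety_negCone {V : Set CRLAlg.{u}} (hV : IsVariety V) :
    IsVariety {A : CRLAlg.{u} | CRLAlg.mk (NegCone A) ∈ V} where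
  hom_image f hf h := hV.of_surjective (NegCone.map f) (NegCone.map_surjective f hf) h
  subalgebra f hf h := hV.of_injective (NegCone.map f) (NegCone.map_injective f hf) h
  product {I} A h := by
    let φ : CRLHom (NegCone (∀ i, A i)) (∀ i, NegCone (A i)) :=
      { toFun := fun a i => ⟨a.val i, a.le_one i⟩
        map_sup := fun _ _ => rfl
        map_inf := fun _ _ => rfl
        map_mul := fun _ _ => rfl
        map_imp := fun _ _ => rfl
        map_one := rfl }
    exact hV.of_injective φ (fun a b hab => NegCone.ext (funext fun i =>
      congrArg NegCone.val (congrFun hab i))) (hV.product (fun i => ⟨NegCone (A i)⟩) h)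

/-! ### The K-expansion as a functor -/

namespace KExp

variable {L : Type u} {M : Type v} [CRL L] [CRL M]

section

variable (x y : KExp L)

@[simp] theorem fst_sup : (x ⊔ y).fst = x.fst ⊔ y.fst := rfl
@[simp] theorem snd_sup : (x ⊔ y).snd = x.snd ⊓ y.snd := rfl
@[simp] theorem fst_inf : (x ⊓ y).fst = x.fst ⊓ y.fst := rfl
@[simp] theorem snd_inf : (x ⊓ y).snd = x.snd ⊔ y.snd := rfl

variable [IsIntegral L]

@[simp] theorem fst_mul : (x * y).fst = x.fst * y.fst := rfl
@[simp] theorem snd_mul : (x * y).snd = (x.fst ⇨ y.snd) ⊓ (y.fst ⇨ x.snd) := rfl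
@[simp] theorem fst_imp : (x ⇨ y).fst = (x.fst ⇨ y.fst) ⊓ (y.snd ⇨ x.snd) := rfl
@[simp] theorem snd_imp : (x ⇨ y).snd = x.fst * y.snd := rfl
@[simp] theorem fst_one : (1 : KExp L).fst = 1 := rfl
@[simp] theorem snd_one : (1 : KExp L).snd = 1 := rfl

end

variable [IsIntegral L] [IsIntegral M]

/-- The action of a homomorphism on K-expansions. -/
def map (f : CRLHom L M) : CRLHom (KExp L) (KExp M) where
  toFun x := ⟨f.toFun x.fst, f.toFun x.snd⟩
  map_sup x y := KExp.ext (f.map_sup _ _) (f.map_inf _ _)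
  map_inf x y := KExp.ext (f.map_inf _ _) (f.map_sup _ _)
  map_mul x y := KExp.ext (f.map_mul _ _) (by simp [f.map_inf, f.map_imp])
  map_imp x y := KExp.ext (by simp [f.map_inf, f.map_imp]) (f.map_mul _ _)
  map_one := KExp.ext f.map_one f.map_one

theorem map_injective (f : CRLHom L M) (hf : Function.Injective f.toFun) :
    Function.Injective (map f).toFun := fun _ _ h =>
  KExp.ext (hf (congrArg KExp.fst h)) (hf (congrArg KExp.snd h))

theorem map_surjective (f : CRLHom L M) (hf : Function.Surjective f.toFun) :
    Function.Surjective (map f).toFun := by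
  rintro ⟨a, b⟩
  obtain ⟨a, rfl⟩ := hf a
  obtain ⟨b, rfl⟩ := hf b
  exact ⟨⟨a, b⟩, rfl⟩

end KExp

/-- The class of integral algebras whose K-expansion lies in a given variety is a variety. -/
theorem isVariety_kExp {V : Set CRLAlg.{u}} (hV : IsVariety V) :
    IsVariety {L : CRLAlg.{u} | ∃ _ : IsIntegral L, CRLAlg.mk (KExp L) ∈ V} where
  hom_image := by
    rintro A B f hf ⟨hA, h⟩
    have hB : IsIntegral B := ⟨fun b => by
      obtain ⟨a, rfl⟩ := hf b
      rw [← f.map_one]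
      exact f.monotone (IsIntegral.le_one a)⟩
    exact ⟨hB, hV.of_surjective (KExp.map f) (KExp.map_surjective f hf) h⟩
  subalgebra := by
    rintro A B f hf ⟨hA, h⟩
    have hB : IsIntegral B := ⟨fun b => by
      rw [← inf_eq_left]
      apply hf
      rw [f.map_inf, f.map_one, inf_eq_left.2 (IsIntegral.le_one _)]⟩
    exact ⟨hB, hV.of_injective (KExp.map f) (KExp.map_injective f hf) h⟩
  product {I} A h := by
    choose hA h using h
    have hP : IsIntegral (∀ i, A i) := ⟨fun a i => (hA i).le_one (a i)⟩
    let φ : CRLHom (KExp (∀ i, A i)) (∀ i, KExp (A i)) :=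
      { toFun := fun x i => ⟨x.fst i, x.snd i⟩
        map_sup := fun _ _ => rfl
        map_inf := fun _ _ => rfl
        map_mul := fun _ _ => rfl
        map_imp := fun _ _ => rfl
        map_one := rfl }
    refine ⟨hP, hV.of_injective φ (fun x y hxy => ?_) (hV.product (fun i => ⟨KExp (A i)⟩) h)⟩
    exact KExp.ext (funext fun i => congrArg KExp.fst (congrFun hxy i))
      (funext fun i => congrArg KExp.snd (congrFun hxy i))

/-- In `K(L)` the map `∼` swaps coordinates and `(a, b) ∧ 1 = (a, 1)`, so each axiom reduces to
simple facts in the coordinates. -/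
theorem isKLattice_kExp (L : Type u) [CRL L] [IsIntegral L] : IsKLattice (KExp L) where
  involutive x := by
    ext <;> simp [imp_one, one_imp, IsIntegral.le_one]
  inf_sup_of_one x y z h := by
    rcases h with rfl | rfl | rfl <;> ext <;> simp [IsIntegral.le_one]
  sup_inf_of_one x y z h := by
    rcases h with rfl | rfl | rfl <;> ext <;> simp [IsIntegral.le_one]
  k1 x y := by
    ext <;> simp [IsIntegral.le_one, imp_one]
  k2 x y := by
    ext <;> simp [IsIntegral.le_one, imp_one, one_imp, mul_comm]

theorem kExp_mem_GNPcL {L : Type u} [CRL L] [IsIntegral L] (hL : CRLAlg.mk L ∈ GH.{u}) :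
    CRLAlg.mk (KExp L) ∈ GNPcL := by
  obtain ⟨-, -, h2, h3⟩ := hL
  refine ⟨⟨isKLattice_kExp L, fun x y z => ?_, fun x => ?_⟩, fun x y => ?_⟩
  · have hd := CRL.inf_sup_of_idem h2
    let : DistribLattice L := DistribLattice.ofInfSupLe fun a b c => (hd a b c).le
    exact KExp.ext (hd _ _ _) (sup_inf_left _ _ _)
  · ext
    · simp [IsIntegral.le_one, h2 x.fst]
    · simp [IsIntegral.le_one, imp_one]
  · ext
    · simp [IsIntegral.le_one, imp_one, h3 x.fst y.fst]
    · simp [IsIntegral.le_one]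

/-! ### Representation of K-lattices -/

namespace IsKLattice

variable {A : Type u} [CRL A] (h : IsKLattice A)
include h

theorem inf_one_sup (x y : A) : (x ⊔ y) ⊓ 1 = (x ⊓ 1) ⊔ (y ⊓ 1) := by
  rw [inf_comm, h.inf_sup_of_one _ _ _ (Or.inl rfl), inf_comm, inf_comm 1 y]

theorem imp_eq_neg (x y : A) : x ⇨ y = (x * (y ⇨ 1)) ⇨ 1 := by
  rw [← imp_imp, h.involutive]

theorem neg_inf (x y : A) : (x ⊓ y) ⇨ 1 = (x ⇨ 1) ⊔ (y ⇨ 1) := by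
  rw [← h.involutive ((x ⇨ 1) ⊔ (y ⇨ 1)), CRL.sup_imp, h.involutive, h.involutive]

/-- Applying `∼` to the second equation gives `x ∨ 1 = y ∨ 1`; distributivity at `1` makes an
element determined by its meet and join with `1`. -/
theorem eq_of_inf_eq_of_neg_inf_eq {x y : A} (h1 : x ⊓ 1 = y ⊓ 1)
    (h2 : (x ⇨ 1) ⊓ 1 = (y ⇨ 1) ⊓ 1) : x = y := by
  have h3 : x ⊔ 1 = y ⊔ 1 := by
    have := congrArg (· ⇨ (1 : A)) h2
    simpa only [h.neg_inf, h.involutive, one_imp] using this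
  calc x = x ⊓ (y ⊔ 1) := by rw [← h3, inf_sup_self]
    _ = (y ⊓ x) ⊔ (y ⊓ 1) := by
      rw [h.inf_sup_of_one _ _ _ (by simp), h1, inf_comm x]
    _ = y := by rw [← h.inf_sup_of_one _ _ _ (by simp), h3, inf_sup_self]

/-- The embedding of a K-lattice into the K-expansion of its negative cone. -/
def embed : CRLHom A (KExp (NegCone A)) := by
  -- Second coordinate of a product: `∼(xy) = x → ∼y`, which (K2) splits into two residuals.
  -- Residuals then follow from `x → y = ∼(x · ∼y)`.
  have hmul (x y : A) : ((x * y) ⇨ 1) ⊓ 1 =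
      ((x ⊓ 1) ⇨ ((y ⇨ 1) ⊓ 1)) ⊓ 1 ⊓ (((y ⊓ 1) ⇨ ((x ⇨ 1) ⊓ 1)) ⊓ 1) := by
    have hn (z w : A) : ((z ⊓ 1) ⇨ (w ⊓ 1)) ⊓ 1 = ((z ⊓ 1) ⇨ w) ⊓ 1 := by
      rw [imp_inf, inf_assoc, inf_eq_right.2 (CRL.one_le_imp_iff.2 inf_le_right)]
    rw [← imp_imp, ← h.k2, h.involutive, hn, hn, inf_inf_distrib_right]
  refine
    { toFun := fun x => ⟨NegCone.neg x, NegCone.neg (x ⇨ 1)⟩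
      map_sup := fun x y => ?_
      map_inf := fun x y => ?_
      map_mul := fun x y => ?_
      map_imp := fun x y => ?_
      map_one := ?_ }
  · ext
    · exact h.inf_one_sup x y
    · simp [CRL.sup_imp, inf_inf_distrib_right]
  · ext
    · simp [inf_inf_distrib_right]
    · simp [h.neg_inf, h.inf_one_sup]
  · ext
    · exact h.k1 x y
    · exact hmul x y
  · ext
    · change (x ⇨ y) ⊓ 1 = _
      rw [h.imp_eq_neg x y, hmul, h.involutive]
      rfl
    · change ((x ⇨ y) ⇨ 1) ⊓ 1 = _
      rw [h.imp_eq_neg x y, h.involutive, h.k1]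
      rfl
  · ext
    · exact inf_idem 1
    · simp [one_imp]

theorem embed_injective : Function.Injective h.embed.toFun := fun _ _ hxy =>
  h.eq_of_inf_eq_of_neg_inf_eq (congrArg (fun z => z.fst.val) hxy)
    (congrArg (fun z => z.snd.val) hxy)

end IsKLattice

theorem negCone_mem_GH {A : Type u} [CRL A] (hA : CRLAlg.mk A ∈ GNPcL.{u}) :
    CRLAlg.mk (NegCone A) ∈ GH := by
  obtain ⟨⟨hK, -, h2⟩, h3⟩ := hA
  have hi : ∀ x : NegCone A, x * x = x := fun x => by
    ext
    have := h2 x.val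
    rwa [inf_eq_left.2 x.le_one] at this
  refine ⟨inferInstanceAs (IsIntegral (NegCone A)), fun x y => ?_, hi, fun x y => ?_⟩
  -- Divisibility is automatic here: idempotence makes the product a meet, so both sides equal `x ⊓
  -- y`.
  · have key : ∀ x y : NegCone A, x * (x ⇨ y) = x ⊓ y := fun x y => by
      refine le_antisymm (le_inf ?_ ?_) ?_
      · rw [CRL.mul_eq_inf hi]
        exact inf_le_left
      · rw [mul_comm]
        exact CRL.imp_mul_le x y
      · rw [CRL.mul_eq_inf hi]
        refine le_inf inf_le_left ((CRL.residuation _ _ _).1 ?_)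
        rw [CRL.mul_eq_inf hi]
        exact inf_le_of_left_le inf_le_right
    exact (key x y).trans ((inf_comm x y).trans (key y x).symm)
  · ext
    have := h3 x.val y.val
    rw [inf_eq_left.2 x.le_one, inf_eq_left.2 y.le_one, hK.inf_one_sup] at this
    exact this

theorem GNPcL_eq_KClass_GH : GNPcL.{u} = KClass GH.{u} := by
  refine Set.Subset.antisymm (fun A hA => ?_) ?_
  · exact ⟨hA.1.1, ⟨NegCone A⟩, negCone_mem_GH hA, inferInstanceAs (IsIntegral (NegCone A)),
      hA.1.1.embed, hA.1.1.embed_injective⟩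
  · rintro A ⟨-, L, hL, hI, f, hf⟩
    exact isVariety_GNPcL.of_injective f hf (kExp_mem_GNPcL hL)

/-! ### The negative cone of a K-expansion -/

/-- The first coordinate, as a homomorphism from the negative cone of `K(L)` to `L`. -/
def negConeKExpFst (L : Type u) [CRL L] [IsIntegral L] : CRLHom (NegCone (KExp L)) L where
  toFun x := x.val.fst
  map_sup _ _ := rfl
  map_inf _ _ := rfl
  map_mul _ _ := rfl
  map_imp x y := by
    -- The negative cone of `K(L)` consists of the pairs `(a, 1)`.
    have : y.val.snd ⇨ x.val.snd = 1 :=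
      CRL.imp_eq_one_iff.2 ((IsIntegral.le_one _).trans x.le_one.2)
    simp [this, IsIntegral.le_one]
  map_one := rfl

theorem negConeKExpFst_injective (L : Type u) [CRL L] [IsIntegral L] :
    Function.Injective (negConeKExpFst L).toFun := fun x y h => by
  refine NegCone.ext (KExp.ext h ?_)
  rw [le_antisymm (IsIntegral.le_one _) x.le_one.2, le_antisymm (IsIntegral.le_one _) y.le_one.2]

/-- The operator `K` commutes with the generation of varieties by a single algebra. -/
theorem varietyGen_kExp (L : Type u) [CRL L] [IsIntegral L] :
    varietyGen {CRLAlg.mk (KExp L)} = KClass (varietyGen {CRLAlg.mk L}) := by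
  refine Set.Subset.antisymm (fun A hA => ?_) ?_
  · have hV := isVariety_varietyGen.{u} {CRLAlg.mk L}
    -- The K-lattices with negative cone in `V(L)` form a variety that contains `K(L)`.
    have hW := isVariety_setOf_isKLattice.inter (isVariety_negCone hV)
    obtain ⟨hK, hN⟩ := (varietyGen_singleton_subset_iff hW).2
      ⟨isKLattice_kExp L, hV.of_injective (negConeKExpFst L) (negConeKExpFst_injective L)
        (subset_varietyGen _ rfl)⟩ hA
    exact ⟨hK, ⟨NegCone A⟩, hN, inferInstanceAs (IsIntegral (NegCone A)),
      IsKLattice.embed hK, IsKLattice.embed_injective hK⟩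
  · rintro A ⟨-, M, hM, hI, f, hf⟩
    have hV := isVariety_varietyGen.{u} {CRLAlg.mk (KExp L)}
    have hL : CRLAlg.mk (KExp L) ∈ varietyGen {CRLAlg.mk (KExp L)} := subset_varietyGen _ rfl
    -- The integral algebras with K-expansion in `V(K(L))` form a variety that contains `L`, hence
    -- `M`.
    obtain ⟨_, h⟩ := (varietyGen_singleton_subset_iff (isVariety_kExp hV)).2 ⟨‹_›, hL⟩ hM
    exact hV.of_injective f hf h


/-! ### Gödel chains -/

/-- Gödel chains: integral, totally ordered and idempotent. -/
class IsGodelChain (C : Type u) [CRL C] : Prop extends IsIntegral C where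
  total : ∀ a b : C, a ≤ b ∨ b ≤ a
  idem : ∀ a : C, a * a = a

/-- The Gödel chain structure on a linear order with a largest element. -/
noncomputable abbrev godelCRL (C : Type u) [LinearOrder C] [OrderTop C] : CRL C where
  __ := (inferInstance : Lattice C)
  mul a b := a ⊓ b
  one := ⊤
  mul_assoc := inf_assoc
  mul_comm := inf_comm
  one_mul := top_inf_eq
  mul_one := inf_top_eq
  himp a b := if a ≤ b then ⊤ else b
  residuation a b c := by
    change a ⊓ b ≤ c ↔ a ≤ (if b ≤ c then ⊤ else c)
    split_ifs with h
    · exact ⟨fun _ => le_top, fun _ => inf_le_right.trans h⟩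
    · rw [inf_le_iff]
      exact ⟨fun H => H.resolve_right h, Or.inl⟩

namespace IsGodelChain

variable {C : Type u} {D : Type v} [CRL C] [IsGodelChain C] [CRL D] [IsGodelChain D] {a b c : C}

theorem imp_of_le (h : a ≤ b) : a ⇨ b = 1 := CRL.imp_eq_one_iff.2 h

theorem mul_eq_inf (a b : C) : a * b = a ⊓ b := CRL.mul_eq_inf idem a b

theorem inf_le_iff : a ⊓ b ≤ c ↔ a ≤ c ∨ b ≤ c := by
  refine ⟨fun h => ?_, fun h => h.elim inf_le_of_left_le inf_le_of_right_le⟩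
  rcases total a b with hab | hab
  · rw [inf_eq_left.2 hab] at h
    exact Or.inl h
  · rw [inf_eq_right.2 hab] at h
    exact Or.inr h

theorem sup_eq_one_iff : a ⊔ b = 1 ↔ a = 1 ∨ b = 1 := by
  constructor
  · intro h
    rcases total a b with hab | hab
    · exact Or.inr (by rwa [sup_eq_right.2 hab] at h)
    · exact Or.inl (by rwa [sup_eq_left.2 hab] at h)
  · rintro (rfl | rfl)
    · exact sup_eq_left.2 (IsIntegral.le_one _)
    · exact sup_eq_right.2 (IsIntegral.le_one _)

theorem imp_of_not_le (h : ¬ a ≤ b) : a ⇨ b = b := by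
  refine eq_of_forall_le_iff fun x => ?_
  rw [← CRL.residuation, mul_eq_inf, inf_le_iff, or_iff_left h]

theorem lt_of_not_ge (h : ¬ a ≤ b) : b < a := lt_of_le_not_ge ((total a b).resolve_left h) h

/-- The linear order of a Gödel chain. -/
noncomputable abbrev linearOrder (C : Type u) [CRL C] [IsGodelChain C] : LinearOrder C :=
  { (inferInstance : Lattice C) with
    le_total := total
    toDecidableLE := Classical.decRel _
    min_def := fun a b => by
      split_ifs with h
      · exact inf_eq_left.2 h
      · exact inf_eq_right.2 ((total a b).resolve_left h)
    max_def := fun a b => by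
      split_ifs with h
      · exact sup_eq_right.2 h
      · exact sup_eq_left.2 ((total a b).resolve_left h) }

/-- An order embedding of Gödel chains that preserves the unit is a homomorphism. -/
def homOfLeIff (f : C → D) (hf : ∀ a b, f a ≤ f b ↔ a ≤ b) (h1 : f 1 = 1) : CRLHom C D :=
  have hinf (a b : C) : f (a ⊓ b) = f a ⊓ f b := by
    rcases total a b with h | h
    · rw [inf_eq_left.2 h, inf_eq_left.2 ((hf _ _).2 h)]
    · rw [inf_eq_right.2 h, inf_eq_right.2 ((hf _ _).2 h)]
  { toFun := f
    map_sup := fun a b => by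
      rcases total a b with h | h
      · rw [sup_eq_right.2 h, sup_eq_right.2 ((hf _ _).2 h)]
      · rw [sup_eq_left.2 h, sup_eq_left.2 ((hf _ _).2 h)]
    map_inf := hinf
    map_mul := fun a b => by rw [mul_eq_inf, mul_eq_inf, hinf]
    map_imp := fun a b => by
      by_cases h : a ≤ b
      · rw [imp_of_le h, imp_of_le ((hf _ _).2 h), h1]
      · rw [imp_of_not_le h, imp_of_not_le (mt (hf _ _).1 h)]
    map_one := h1 }

end IsGodelChain

theorem isGodelChain_godelCRL (C : Type u) [LinearOrder C] [OrderTop C] :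
    @IsGodelChain C (godelCRL C) :=
  letI := godelCRL C
  { le_one := fun _ => le_top
    total := le_total
    idem := inf_idem }

instance (n : ℕ) [NeZero n] : IsGodelChain (GodelChain.{u} n) where
  le_one a := (le_top : a ≤ ⊤)
  total := le_total
  idem := inf_idem

/-! ### Separation of points by homomorphisms to chains -/

/-- Filters of a commutative residuated lattice. -/
structure IsFilter {L : Type u} [CRL L] (F : Set L) : Prop where
  one_mem : (1 : L) ∈ F
  mem_of_le : ∀ {a b}, a ∈ F → a ≤ b → b ∈ F
  inf_mem : ∀ {a b}, a ∈ F → b ∈ F → a ⊓ b ∈ F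

theorem IsFilter.inf_mem_iff {L : Type u} [CRL L] {F : Set L} (hF : IsFilter F) {a b : L} :
    a ⊓ b ∈ F ↔ a ∈ F ∧ b ∈ F :=
  ⟨fun h => ⟨hF.mem_of_le h inf_le_left, hF.mem_of_le h inf_le_right⟩,
    fun h => hF.inf_mem h.1 h.2⟩

/-- Every element other than `1` of an idempotent integral algebra is missed by a prime filter. -/
theorem exists_prime_filter {L : Type u} [CRL L] [IsIntegral L] (hi : ∀ x : L, x * x = x)
    {d : L} (hd : d ≠ 1) :
    ∃ F : Set L, IsFilter F ∧ d ∉ F ∧ ∀ x y, x ⊔ y ∈ F → x ∈ F ∨ y ∈ F := by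
  have h0 : ({1} : Set L) ∈ {F : Set L | IsFilter F ∧ d ∉ F} :=
    ⟨⟨rfl, fun {a b} ha hab => le_antisymm (IsIntegral.le_one _) (Set.mem_singleton_iff.1 ha ▸ hab),
      fun {a b} ha hb => by
        rw [Set.mem_singleton_iff.1 ha, Set.mem_singleton_iff.1 hb, inf_idem]
        exact rfl⟩, hd⟩
  obtain ⟨F, -, hF⟩ := zorn_subset_nonempty {F : Set L | IsFilter F ∧ d ∉ F} (by
    rintro c hc hchain ⟨G, hG⟩
    refine ⟨⋃₀ c, ⟨⟨⟨G, hG, (hc hG).1.one_mem⟩, ?_, ?_⟩, ?_⟩, fun s => Set.subset_sUnion_of_mem⟩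
    · rintro a b ⟨s, hs, ha⟩ hab
      exact ⟨s, hs, (hc hs).1.mem_of_le ha hab⟩
    · rintro a b ⟨s, hs, ha⟩ ⟨t, ht, hb⟩
      rcases hchain.total hs ht with h | h
      · exact ⟨t, ht, (hc ht).1.inf_mem (h ha) hb⟩
      · exact ⟨s, hs, (hc hs).1.inf_mem ha (h hb)⟩
    · rintro ⟨s, hs, ha⟩
      exact (hc hs).2 ha) _ h0
  obtain ⟨⟨hF1, hF2⟩, hmax⟩ := hF
  -- By maximality of `F`, the filter generated by `F` and `x` must contain `d`.
  have key (x : L) (hx : x ∉ F) : ∃ f ∈ F, f ⊓ x ≤ d := by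
    by_contra! h
    refine hx (hmax (y := {z | ∃ f ∈ F, f ⊓ x ≤ z}) ⟨⟨⟨1, hF1.one_mem, IsIntegral.le_one _⟩, ?_, ?_⟩,
      fun ⟨f, hf, hle⟩ => h f hf hle⟩ (fun z hz => ⟨z, hz, inf_le_left⟩)
      ⟨1, hF1.one_mem, inf_le_right⟩)
    · rintro a b ⟨f, hf, ha⟩ hab
      exact ⟨f, hf, ha.trans hab⟩
    · rintro a b ⟨f, hf, ha⟩ ⟨g, hg, hb⟩
      exact ⟨f ⊓ g, hF1.inf_mem hf hg, le_inf ((inf_le_inf_right x inf_le_left).trans ha)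
        ((inf_le_inf_right x inf_le_right).trans hb)⟩
  refine ⟨F, hF1, hF2, fun x y hxy => ?_⟩
  by_contra! h
  obtain ⟨f, hf, hx⟩ := key x h.1
  obtain ⟨g, hg, hy⟩ := key y h.2
  refine hF2 (hF1.mem_of_le (hF1.inf_mem (hF1.inf_mem hf hg) hxy) ?_)
  rw [CRL.inf_sup_of_idem hi]
  exact sup_le ((inf_le_inf_right x inf_le_left).trans hx)
    ((inf_le_inf_right y inf_le_right).trans hy)

/-- The points of a Gödel hoop are separated by homomorphisms onto Gödel chains. -/
theorem exists_hom_godelChain {L : Type u} [CRL L] (hL : CRLAlg.mk L ∈ GH.{u}) {a b : L}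
    (hab : a ≠ b) : ∃ (C : Type u) (_ : CRL C) (_ : IsGodelChain C) (q : CRLHom L C),
      Function.Surjective q.toFun ∧ q.toFun a ≠ q.toFun b := by
  classical
  wlog hle : ¬ a ≤ b generalizing a b
  · obtain ⟨C, _, _, q, hq, hne⟩ := this hab.symm fun h => hab (le_antisymm (not_not.1 hle) h)
    exact ⟨C, _, ‹_›, q, hq, hne.symm⟩
  obtain ⟨hint, -, hi, hp⟩ := hL
  have : IsIntegral L := hint
  obtain ⟨F, hF, hdF, hpr⟩ := exists_prime_filter hi (mt CRL.imp_eq_one_iff.1 hle)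
  have htrans {x y z : L} (hxy : (x ⇨ y) ∈ F) (hyz : (y ⇨ z) ∈ F) : (x ⇨ z) ∈ F := by
    refine hF.mem_of_le (hF.inf_mem hyz hxy) ?_
    rw [← CRL.mul_eq_inf hi, ← CRL.residuation, mul_assoc]
    refine (CRL.mul_le_mul le_rfl (CRL.imp_mul_le x y)).trans (CRL.imp_mul_le y z)
  have hrefl (x : L) : (x ⇨ x) ∈ F := by
    rw [CRL.imp_eq_one_iff.2 le_rfl]
    exact hF.one_mem
  -- The quotient `L/F` is realized by these sets ordered by inclusion, since `S x ⊆ S y` iff `x → y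
  -- ∈ F`.
  let S : L → Set L := fun x => {y | (y ⇨ x) ∈ F}
  have hS {x y : L} : S x ⊆ S y ↔ (x ⇨ y) ∈ F :=
    ⟨fun h => h (hrefl x), fun h z hz => htrans hz h⟩
  let C := Set.range S
  let q : L → C := fun x => ⟨S x, x, rfl⟩
  have hqs : Function.Surjective q := by
    rintro ⟨_, x, rfl⟩
    exact ⟨x, rfl⟩
  let : LinearOrder C :=
    { (inferInstance : PartialOrder C) with
      le_total := by
        rintro ⟨_, x, rfl⟩ ⟨_, y, rfl⟩
        -- Prelinearity together with primeness of `F` makes the quotient a chain.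
        exact (hpr _ _ (by rw [hp x y]; exact hF.one_mem)).imp hS.2 hS.2
      toDecidableLE := Classical.decRel _ }
  let : OrderTop C :=
    { top := q 1
      le_top := by
        rintro ⟨_, x, rfl⟩
        exact hS.2 (by rw [imp_one]; exact hF.one_mem) }
  let : CRL C := godelCRL C
  have : IsGodelChain C := isGodelChain_godelCRL C
  have hq {x y : L} : q x ≤ q y ↔ (x ⇨ y) ∈ F := hS
  have hinf (x y : L) : q (x ⊓ y) = q x ⊓ q y := eq_of_forall_le_iff fun c => by
    obtain ⟨z, rfl⟩ := hqs c
    rw [le_inf_iff, hq, hq, hq, imp_inf, hF.inf_mem_iff]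
  have hmul (x y : L) : q (x * y) = q x * q y := by
    rw [CRL.mul_eq_inf hi, IsGodelChain.mul_eq_inf, hinf]
  refine ⟨C, _, ‹_›, ⟨q, fun x y => ?_, hinf, hmul, fun x y => ?_, rfl⟩, hqs,
    fun h => hdF (hq.1 h.le)⟩
  · refine eq_of_forall_ge_iff fun c => ?_
    obtain ⟨z, rfl⟩ := hqs c
    rw [sup_le_iff, hq, hq, hq, CRL.sup_imp, hF.inf_mem_iff]
  · refine eq_of_forall_le_iff fun c => ?_
    obtain ⟨z, rfl⟩ := hqs c
    rw [← CRL.residuation, ← hmul, hq, hq, imp_imp]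

/-- The points of an algebra in `GNPcL` are separated by homomorphisms to K-expansions of
Gödel chains that are onto on negative cones. -/
theorem exists_hom_kExp_godelChain {A : Type u} [CRL A] (hA : CRLAlg.mk A ∈ GNPcL.{u}) {x y : A}
    (hxy : x ≠ y) : ∃ (C : Type u) (_ : CRL C) (_ : IsGodelChain C) (g : CRLHom A (KExp C)),
      (∀ c : C, ⟨c, 1⟩ ∈ Set.range g.toFun) ∧ g.toFun x ≠ g.toFun y := by
  have hK : IsKLattice A := hA.1.1
  obtain ⟨C, _, _, q, hq, hne⟩ : ∃ (C : Type u) (_ : CRL C) (_ : IsGodelChain C)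
      (q : CRLHom (NegCone A) C), Function.Surjective q.toFun ∧
        (KExp.map q).toFun (hK.embed.toFun x) ≠ (KExp.map q).toFun (hK.embed.toFun y) := by
    by_cases h : (hK.embed.toFun x).fst = (hK.embed.toFun y).fst
    · have h' : (hK.embed.toFun x).snd ≠ (hK.embed.toFun y).snd :=
        fun h' => hxy (hK.embed_injective (KExp.ext h h'))
      obtain ⟨C, _, _, q, hq, hne⟩ := exists_hom_godelChain (negCone_mem_GH hA) h'
      exact ⟨C, _, ‹_›, q, hq, fun h => hne (congrArg KExp.snd h)⟩
    · obtain ⟨C, _, _, q, hq, hne⟩ := exists_hom_godelChain (negCone_mem_GH hA) h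
      exact ⟨C, _, ‹_›, q, hq, fun h => hne (congrArg KExp.fst h)⟩
  refine ⟨C, _, ‹_›, (KExp.map q).comp hK.embed, fun c => ?_, hne⟩
  obtain ⟨n, rfl⟩ := hq c
  -- A negative `n` embeds as `(n, 1)`, because `1 ≤ ∼n`.
  refine ⟨n.val, KExp.ext (congrArg q.toFun (NegCone.ext (inf_eq_left.2 n.le_one))) ?_⟩
  refine (congrArg q.toFun (NegCone.ext ?_)).trans q.map_one
  exact inf_eq_right.2 (CRL.one_le_imp_iff.2 n.le_one)

/-- A subalgebra of the K-expansion of a chain that contains the negative cone contains every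
point, except possibly the one with both coordinates minimal. -/
theorem IsSubuniverse.mem_of_negCone {C : Type u} [CRL C] [IsGodelChain C] {R : Set (KExp C)}
    (hR : IsSubuniverse R) (h : ∀ c : C, ⟨c, 1⟩ ∈ R) {z : KExp C}
    (hz : z.fst = z.snd → ∃ d, d < z.fst) : z ∈ R := by
  have hneg {a b : C} (hab : ⟨a, b⟩ ∈ R) : (⟨b, a⟩ : KExp C) ∈ R := by
    convert hR.imp_mem hab hR.one_mem using 1
    ext <;> simp [imp_one, one_imp, IsIntegral.le_one]
  have hlt {a b : C} (hab : b < a) : (⟨a, b⟩ : KExp C) ∈ R := by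
    -- For `b < a`, `(a, 1)(1, b) = (a, a → b) = (a, b)`.
    convert hR.mul_mem (h a) (hneg (h b)) using 1
    ext
    · simp
    · simp [IsGodelChain.imp_of_not_le hab.not_ge, imp_one, IsIntegral.le_one]
  obtain ⟨a, b⟩ := z
  by_cases hab : a = b
  · subst hab
    obtain ⟨d, hd⟩ := hz rfl
    -- A diagonal point needs some `d` below it: `(a, a) = (a, 1) ∨ (d, a)`.
    convert hR.sup_mem (h a) (hneg (hlt hd)) using 1
    ext
    · exact (sup_eq_left.2 hd.le).symm
    · exact (inf_eq_right.2 (IsIntegral.le_one _)).symm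
  · rcases IsGodelChain.total a b with hle | hle
    · exact hneg (hlt (lt_of_le_of_ne hle hab))
    · exact hlt (lt_of_le_of_ne hle (Ne.symm hab))

/-! ### Finite chains -/

/-- A finite subset of a Gödel chain that contains `1` is a subalgebra isomorphic to some `G_n`. -/
theorem exists_hom_of_finset {C : Type u} [CRL C] [IsGodelChain C] {n : ℕ} (s : Finset C)
    (hs : s.card = n + 1) (h1 : (1 : C) ∈ s) : ∃ f : CRLHom (GodelChain.{u} (n + 1)) C,
      Function.Injective f.toFun ∧ Set.range f.toFun = s := by
  let := IsGodelChain.linearOrder C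
  let e := s.orderEmbOfFin hs
  have he : Set.range e = s := s.range_orderEmbOfFin hs
  have hone : e (1 : GodelChain.{u} (n + 1)).val = 1 := by
    obtain ⟨i, hi⟩ : (1 : C) ∈ Set.range e := he ▸ h1
    refine le_antisymm (IsIntegral.le_one (A := C) _) ?_
    rw [← hi]
    exact e.monotone (GodelChain.le_def.1 (IsIntegral.le_one (⟨i⟩ : GodelChain.{u} (n + 1))))
  refine ⟨IsGodelChain.homOfLeIff (fun a => e a.val) (fun a b => e.le_iff_le) hone,
    fun a b h => GodelChain.ext (e.injective h), ?_⟩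
  rw [← he]
  ext c
  exact ⟨fun ⟨a, ha⟩ => ⟨a.val, ha⟩, fun ⟨i, hi⟩ => ⟨⟨i⟩, hi⟩⟩

theorem exists_finset_or_card_le (C : Type u) (c : C) (n : ℕ) :
    (∃ s : Finset C, s.card = n + 1 ∧ c ∈ s) ∨ (Finite C ∧ Nat.card C ≤ n) := by
  classical
  rcases finite_or_infinite C with hC | hC
  · have := Fintype.ofFinite C
    by_cases hn : Nat.card C ≤ n
    · exact Or.inr ⟨hC, hn⟩
    · rw [Nat.card_eq_fintype_card, not_le, ← Finset.card_univ] at hn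
      obtain ⟨s, hs, -, hc⟩ := Finset.exists_subsuperset_card_eq (n := n + 1)
        (Finset.subset_univ {c}) (by simp) hn
      exact Or.inl ⟨s, hc, hs (Finset.mem_singleton_self c)⟩
  · obtain ⟨s, hs, hc⟩ := Infinite.exists_superset_card_eq {c} (n + 1) (by simp)
    exact Or.inl ⟨s, hc, hs (Finset.mem_singleton_self c)⟩

/-- A chain with at most `n` elements embeds into `G_n`, the bottom being avoided by chains with
fewer than `n` elements. -/
theorem exists_hom_godelChain_of_card_le {C : Type u} [CRL C] [IsGodelChain C] [Finite C] {n : ℕ}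
    [NeZero n] (hn : Nat.card C ≤ n) : ∃ f : CRLHom C (GodelChain.{u} n),
      Function.Injective f.toFun ∧ ∀ c, f.toFun c = ⊥ → n ≤ Nat.card C ∧ ∀ d, c ≤ d := by
  have hins (c : C) : (insert c {d | c < d}).ncard = {d | c < d}.ncard + 1 :=
    Set.ncard_insert_of_notMem (fun h => lt_irrefl c h) (Set.toFinite _)
  have hcard (c : C) : {d | c < d}.ncard + 1 ≤ Nat.card C := hins c ▸ Set.ncard_le_card _
  -- Counting from the top aligns the units, so a shorter chain leaves the bottom free.
  let f : C → GodelChain.{u} n := fun c => ⟨Fin.rev ⟨{d | c < d}.ncard, by have := hcard c; omega⟩⟩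
  have hf (a b : C) : f a ≤ f b ↔ a ≤ b := by
    rw [GodelChain.le_def, Fin.rev_le_rev, Fin.mk_le_mk]
    constructor
    · intro h
      by_contra hab
      have hlt := IsGodelChain.lt_of_not_ge hab
      have hsub : insert a {d | a < d} ⊆ {d | b < d} :=
        Set.insert_subset hlt fun d hd => hlt.trans hd
      have := Set.ncard_le_ncard hsub (Set.toFinite _)
      rw [hins] at this
      omega
    · exact fun h => Set.ncard_le_ncard (fun d hd => lt_of_le_of_lt h hd) (Set.toFinite _)
  have h1 : f 1 = 1 := by
    have : {d : C | 1 < d} = ∅ :=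
      Set.eq_empty_of_forall_notMem fun d hd => absurd (IsIntegral.le_one d) (not_le_of_gt hd)
    refine GodelChain.ext (congrArg Fin.rev (Fin.ext ?_))
    simp [this]
  refine ⟨IsGodelChain.homOfLeIff f hf h1, fun a b h => le_antisymm ((hf _ _).1 h.le)
    ((hf _ _).1 h.ge), fun c hc => ⟨?_, fun d => (hf _ _).1 ?_⟩⟩
  · have h2 := congrArg (fun x => (GodelChain.val x).val) hc
    have h3 := hcard c
    have h4 : n - ({d | c < d}.ncard + 1) = 0 := h2
    omega
  · exact (bot_le (a := f d)).trans' hc.le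


/-! ### The algebras `K_{n²}` and `K_{n²-1}` in varieties -/

theorem mk_mem_GH_of_isGodelChain (C : Type u) [CRL C] [hC : IsGodelChain C] :
    CRLAlg.mk C ∈ GH := by
  refine ⟨hC.toIsIntegral, fun x y => ?_, hC.idem, fun x y => ?_⟩
  · have key {x y : C} (h : x ≤ y) : x * (x ⇨ y) = y * (y ⇨ x) := by
      rw [IsGodelChain.imp_of_le h, mul_one]
      refine le_antisymm ?_ ?_
      · rw [IsGodelChain.mul_eq_inf]
        refine le_inf h ((CRL.residuation _ _ _).1 ?_)
        rw [IsGodelChain.mul_eq_inf]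
        exact inf_le_left
      · rw [mul_comm]
        exact CRL.imp_mul_le y x
    exact (hC.total x y).elim key fun h => (key h).symm
  · exact IsGodelChain.sup_eq_one_iff.2
      ((hC.total x y).imp IsGodelChain.imp_of_le IsGodelChain.imp_of_le)

theorem card_godelChain (n : ℕ) : Nat.card (GodelChain.{u} n) = n := by
  rw [Nat.card_congr (⟨GodelChain.val, GodelChain.mk, fun _ => rfl, fun _ => rfl⟩ :
    GodelChain.{u} n ≃ Fin n), Nat.card_fin]

instance (n : ℕ) : Finite (GodelChain.{u} n) :=
  Finite.of_injective GodelChain.val fun _ _ => GodelChain.ext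

namespace IsVariety

variable {V : Set CRLAlg.{u}} (hV : IsVariety V)
include hV

theorem algKSqPred_mem {m : ℕ} (h : algKSq (m + 2) ∈ V) : algKSqPred m ∈ V :=
  let := (puncture_isSubuniverse.{u} m).crl
  hV.of_injective (puncture_isSubuniverse m).incl Subtype.val_injective h

/-- `G_n` embeds in the longer chain `G_{m+2}` avoiding its bottom, so `K(G_n)` avoids the removed
point. -/
theorem algKSq_mem_of_algKSqPred_mem {m n : ℕ} [NeZero n] (hn : n ≤ m + 1)
    (h : algKSqPred m ∈ V) : algKSq n ∈ V := by
  have hc := card_godelChain.{u} n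
  obtain ⟨f, hf, hbot⟩ := exists_hom_godelChain_of_card_le (C := GodelChain.{u} n) (n := m + 2)
    (by omega)
  let := (puncture_isSubuniverse.{u} m).crl
  refine hV.of_injective ((puncture_isSubuniverse m).codRestrict (KExp.map f) fun x hx => ?_)
    (fun x y hxy => KExp.map_injective f hf (congrArg Subtype.val hxy)) h
  have := (hbot x.fst (congrArg KExp.fst hx)).1
  omega

variable {A : Type u} [CRL A] {C : Type u} [CRL C] [IsGodelChain C] {g : CRLHom A (KExp C)}
  {m : ℕ} {s : Finset C}

/-- Diagonal points of the punctured algebra lie strictly above the least element of the subchain,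
so the range of `g` contains its copy. -/
theorem algKSqPred_mem_of_hom (hA : CRLAlg.mk A ∈ V) (hg : ∀ c : C, ⟨c, 1⟩ ∈ Set.range g.toFun)
    (hs : s.card = m + 2) (h1 : (1 : C) ∈ s) : algKSqPred m ∈ V := by
  obtain ⟨f, hf, -⟩ := exists_hom_of_finset s hs h1
  let := (puncture_isSubuniverse.{u} m).crl
  refine hV.of_range hA g ((KExp.map f).comp (puncture_isSubuniverse m).incl)
    ((KExp.map_injective f hf).comp Subtype.val_injective) ?_
  rintro _ ⟨⟨z, hz⟩, rfl⟩
  refine g.isSubuniverse_range.mem_of_negCone hg fun heq => ⟨f.toFun ⊥, ?_⟩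
  have heq' : z.fst = z.snd := hf heq
  refine lt_of_le_of_ne (f.monotone bot_le) fun hb => hz (KExp.ext (hf hb).symm ?_)
  exact heq' ▸ (hf hb).symm

/-- Here the one point that `g` might miss is supplied, so `g` is onto and no puncture is needed. -/
theorem algKSq_mem_of_hom (hA : CRLAlg.mk A ∈ V) (hg : ∀ c : C, ⟨c, 1⟩ ∈ Set.range g.toFun)
    {e : C} (he : ∀ d, e ≤ d) (heg : ⟨e, e⟩ ∈ Set.range g.toFun)
    (hs : s.card = m + 2) (h1 : (1 : C) ∈ s) : algKSq (m + 2) ∈ V := by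
  obtain ⟨f, hf, -⟩ := exists_hom_of_finset s hs h1
  refine hV.of_range hA g (KExp.map f) (KExp.map_injective f hf) ?_
  rintro z -
  by_cases hz : z.fst = z.snd → ∃ d, d < z.fst
  · exact g.isSubuniverse_range.mem_of_negCone hg hz
  · push Not at hz
    have : z.fst = e := le_antisymm
      ((IsGodelChain.total _ _).elim id fun h => (eq_of_le_of_not_lt h (hz.2 e)).ge) (he _)
    rwa [show z = ⟨e, e⟩ from KExp.ext this (hz.1.symm.trans this)]

end IsVariety

/-! ### The generators as a single sequence -/

/-- The enumeration `K₃, K₄, K₈, K₉, …` of the algebras `K_{n²-1}` and `K_{n²}`, `n ≥ 2`. -/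
def kAlg (j : ℕ) : CRLAlg.{u} := if j % 2 = 0 then algKSqPred (j / 2) else algKSq (j / 2 + 2)

/-- The index of `kAlg j`. -/
def kIndex (j : ℕ) : ℕ := if j % 2 = 0 then (j / 2 + 2) ^ 2 - 1 else (j / 2 + 2) ^ 2

theorem kAlg_even (m : ℕ) : kAlg.{u} (2 * m) = algKSqPred m := by
  rw [kAlg, if_pos (by omega), show 2 * m / 2 = m by omega]

theorem kAlg_odd (m : ℕ) : kAlg.{u} (2 * m + 1) = algKSq (m + 2) := by
  have h : (2 * m + 1) / 2 = m := by omega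
  rw [kAlg, if_neg (by omega)]
  congr 1
  rw [h]

theorem kIndex_even (m : ℕ) : kIndex (2 * m) = (m + 2) ^ 2 - 1 := by
  rw [kIndex, if_pos (by omega), show 2 * m / 2 = m by omega]

theorem kIndex_odd (m : ℕ) : kIndex (2 * m + 1) = (m + 2) ^ 2 := by
  rw [kIndex, if_neg (by omega), show (2 * m + 1) / 2 = m by omega]

theorem even_or_odd_index (j : ℕ) : ∃ m, j = 2 * m ∨ j = 2 * m + 1 := ⟨j / 2, by omega⟩

theorem strictMono_kIndex : StrictMono kIndex := strictMono_nat_of_lt_succ fun j => by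
  obtain ⟨m, rfl | rfl⟩ := even_or_odd_index j
  · rw [kIndex_even, kIndex_odd]
    have : 0 < (m + 2) ^ 2 := by positivity
    omega
  · rw [kIndex_odd, show 2 * m + 1 + 1 = 2 * (m + 1) by ring, kIndex_even]
    have : (m + 1 + 2) ^ 2 = (m + 2) ^ 2 + 2 * m + 5 := by ring
    omega

theorem isK_iff {k : ℕ} {A : CRLAlg.{u}} : IsK k A ↔ ∃ j, k = kIndex j ∧ A = kAlg j := by
  constructor
  · rintro (m | m)
    · exact ⟨2 * m + 1, (kIndex_odd m).symm, (kAlg_odd m).symm⟩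
    · exact ⟨2 * m, (kIndex_even m).symm, (kAlg_even m).symm⟩
  · rintro ⟨j, rfl, rfl⟩
    obtain ⟨m, rfl | rfl⟩ := even_or_odd_index j
    · rw [kIndex_even, kAlg_even]
      exact IsK.sqPred m
    · rw [kIndex_odd, kAlg_odd]
      exact IsK.sq m

/-- Each algebra embeds in the next: `K_{n²-1}` in `K_{n²}`, and `K_{n²}` in `K_{(n+1)²-1}`. -/
theorem IsVariety.kAlg_mem_of_le {V : Set CRLAlg.{u}} (hV : IsVariety V) {i j : ℕ} (hij : i ≤ j)
    (h : kAlg j ∈ V) : kAlg i ∈ V := by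
  induction j, hij using Nat.le_induction with
  | base => exact h
  | succ j _ ih =>
    refine ih ?_
    obtain ⟨m, rfl | rfl⟩ := even_or_odd_index j
    · rw [kAlg_odd] at h
      rw [kAlg_even]
      exact hV.algKSqPred_mem h
    · rw [show 2 * m + 1 + 1 = 2 * (m + 1) by ring, kAlg_even] at h
      rw [kAlg_odd]
      exact hV.algKSq_mem_of_algKSqPred_mem le_rfl h

theorem kAlg_mem_GNPcL (j : ℕ) : kAlg.{u} j ∈ GNPcL := by
  refine isVariety_GNPcL.kAlg_mem_of_le (show j ≤ 2 * j + 1 by omega) ?_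
  rw [kAlg_odd]
  exact kExp_mem_GNPcL (mk_mem_GH_of_isGodelChain _)

/-! ### Classification of the subvarieties -/

/-- The proper subvarieties of `GNPcL`, in increasing order. -/
def kVariety : ℕ → Set CRLAlg.{u}
  | 0 => trivialVariety
  | j + 1 => varietyGen {kAlg j}

theorem isVariety_kVariety (n : ℕ) : IsVariety (kVariety.{u} n) := by
  cases n with
  | zero => exact isVariety_trivialVariety
  | succ j => exact isVariety_varietyGen _

/-- A variety that contains all algebras `kAlg j` contains `GNPcL`. -/
theorem GNPcL_subset_of_forall_kAlg_mem {W : Set CRLAlg.{u}} (hW : IsVariety W)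
    (h : ∀ j, kAlg j ∈ W) : GNPcL ⊆ W := by
  classical
  refine fun A hA => hW.of_separating fun x y hxy => ?_
  obtain ⟨C, _, _, g, -, hne⟩ := exists_hom_kExp_godelChain hA hxy
  refine ⟨⟨KExp C⟩, hW.of_local fun T => ?_, g, hne⟩
  -- The coordinates of `T` together with `1` form a finite subchain, whose K-expansion covers `T`.
  let s : Finset C := insert 1 (T.image KExp.fst ∪ T.image KExp.snd)
  obtain ⟨n, hn⟩ : ∃ n, s.card = n + 1 :=
    Nat.exists_eq_succ_of_ne_zero (Finset.card_ne_zero.2 (Finset.insert_nonempty _ _))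
  obtain ⟨f, -, hr⟩ := exists_hom_of_finset s hn (Finset.mem_insert_self _ _)
  -- Passing through `K_{(n+2)²-1}` also handles `n = 0`, where `K_1` is not in the enumeration.
  refine ⟨algKSq (n + 1), hW.algKSq_mem_of_algKSqPred_mem le_rfl (kAlg_even n ▸ h (2 * n)),
    KExp.map f, fun z hz => ?_⟩
  have h1 : z.fst ∈ Set.range f.toFun := hr ▸ Finset.mem_coe.2 (Finset.mem_insert_of_mem
    (Finset.mem_union_left _ (Finset.mem_image_of_mem _ hz)))
  have h2 : z.snd ∈ Set.range f.toFun := hr ▸ Finset.mem_coe.2 (Finset.mem_insert_of_mem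
    (Finset.mem_union_right _ (Finset.mem_image_of_mem _ hz)))
  obtain ⟨a, ha⟩ := h1
  obtain ⟨b, hb⟩ := h2
  exact ⟨⟨a, b⟩, KExp.ext ha hb⟩

theorem kVariety_subset {W : Set CRLAlg.{u}} (hW : IsVariety W) {n : ℕ}
    (h : ∀ j < n, kAlg j ∈ W) : kVariety n ⊆ W := by
  cases n with
  | zero => exact fun A (hA : Subsingleton A) => hW.of_subsingleton
  | succ j => exact (varietyGen_singleton_subset_iff hW).2 (h j (Nat.lt_succ_self j))

/-- A subvariety of `GNPcL` without the `n`-th algebra of the enumeration is contained in the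
variety generated by its predecessors. -/
theorem subset_kVariety {W : Set CRLAlg.{u}} (hW : IsVariety W) (hWG : W ⊆ GNPcL) {n : ℕ}
    (h : kAlg n ∉ W) : W ⊆ kVariety n := by
  refine fun A hA => (isVariety_kVariety n).of_separating fun x y hxy => ?_
  obtain ⟨C, _, _, g, hg, hne⟩ := exists_hom_kExp_godelChain (hWG hA) hxy
  -- A missing `K_{(m+2)²-1}` bounds the length of the chains.
  have hcard {m : ℕ} (hm : algKSqPred m ∉ W) : Finite C ∧ Nat.card C ≤ m + 1 :=
    (exists_finset_or_card_le C 1 (m + 1)).resolve_left fun ⟨s, hs, h1⟩ =>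
      hm (hW.algKSqPred_mem_of_hom hA hg hs h1)
  obtain ⟨m, rfl | rfl⟩ := even_or_odd_index n
  · rw [kAlg_even] at h
    obtain ⟨_, hc⟩ := hcard h
    cases m with
    | zero =>
      have : Subsingleton C := Finite.card_le_one_iff_subsingleton.1 hc
      exact absurd (KExp.ext (Subsingleton.elim _ _) (Subsingleton.elim _ _)) hne
    | succ m =>
      obtain ⟨f, hf, -⟩ := exists_hom_godelChain_of_card_le (n := m + 2) hc
      refine ⟨algKSq (m + 2), ?_, (KExp.map f).comp g, (KExp.map_injective f hf).ne hne⟩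
      rw [← kAlg_odd]
      exact subset_varietyGen _ rfl
  · rw [kAlg_odd] at h
    obtain ⟨_, hc⟩ := hcard (m := m + 1) fun h' => h (hW.algKSq_mem_of_algKSqPred_mem le_rfl h')
    obtain ⟨f, hf, hbot⟩ := exists_hom_godelChain_of_card_le (n := m + 2) hc
    -- If the image met `(⊥, ⊥)`, then `C` would have exactly `m + 2` elements and `g` would hit its
    -- least diagonal point, forcing `K_{(m+2)²}` into `W`.
    have hp : ∀ a, ((KExp.map f).comp g).toFun a ∈ puncture (m + 2) := fun a ha => h (by
      have h1 : f.toFun (g.toFun a).fst = ⊥ := congrArg KExp.fst ha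
      have h2 : f.toFun (g.toFun a).snd = ⊥ := congrArg KExp.snd ha
      obtain ⟨hcc, he⟩ := hbot _ h1
      have := Fintype.ofFinite C
      refine hW.algKSq_mem_of_hom hA hg he ⟨a, KExp.ext rfl (hf (h2.trans h1.symm))⟩
        (s := Finset.univ) ?_ (Finset.mem_univ _)
      rw [Finset.card_univ, ← Nat.card_eq_fintype_card]
      exact le_antisymm hc hcc)
    let := (puncture_isSubuniverse.{u} m).crl
    refine ⟨algKSqPred m, ?_, (puncture_isSubuniverse m).codRestrict _ hp,
      fun heq => (KExp.map_injective f hf).ne hne (congrArg Subtype.val heq)⟩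
    rw [← kAlg_even]
    exact subset_varietyGen _ rfl

/-- The subvarieties of `GNPcL` are `GNPcL` and the members of the enumeration. -/
theorem eq_GNPcL_or_eq_kVariety {W : Set CRLAlg.{u}} (hW : IsVariety W) (hWG : W ⊆ GNPcL) :
    W = GNPcL ∨ ∃ n, W = kVariety n := by
  classical
  by_cases h : ∀ j, kAlg j ∈ W
  · exact Or.inl (hWG.antisymm (GNPcL_subset_of_forall_kAlg_mem hW h))
  · push Not at h
    -- The first missing index gives both inclusions.
    exact Or.inr ⟨Nat.find h, (subset_kVariety hW hWG (Nat.find_spec h)).antisymm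
      (kVariety_subset hW fun j hj => not_not.1 (Nat.find_min h hj))⟩

/-! ### Identities that separate the subvarieties -/

namespace Term

/-- The join of `b` and the terms `xᵢ → xᵢ₊₁` for `i < n`, on negative parts. -/
def descent (b : Term) : ℕ → Term
  | 0 => b
  | n + 1 => sup (descent b n) (imp (inf (var n) one) (inf (var (n + 1)) one))

/-- A term with negative part `1` in the K-expansion of a chain iff `x₀ ≤ x₁` there. -/
def stepTerm : Term := imp (inf (var 0) one) (inf (var 1) one)

/-- A term with negative part `1` in the K-expansion of a chain iff a coordinate of the variable
`y` exceeds `x`, or `x` is `1`. -/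
def exceedTerm (x y : ℕ) : Term :=
  imp (inf (imp (sup (inf (var y) one) (inf (imp (var y) one) one)) (inf (var x) one)) one)
    (inf (var x) one)

/-- The identity `t ∧ 1 = 1`. -/
def oneLe (t : Term) : Set (Term × Term) := {(inf t one, one)}

/-- The identity that holds in `kAlg j` and fails in `kAlg (j + 1)`. -/
def separator (j : ℕ) : Set (Term × Term) :=
  -- With `m = j / 2`: if `x₀ > … > x_{m+1}` in `G_{m+2}`, then `x_{m+1}` is the bottom, and a
  -- further variable exceeds it in some coordinate unless its value is `(⊥, ⊥)`.
  if j % 2 = 0 then oneLe (descent (exceedTerm (j / 2 + 1) (j / 2 + 2)) (j / 2 + 1))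
  -- No `m + 3` elements descend strictly in `G_{m+2}`. The base `stepTerm` merely repeats the
  -- clause `i = 0`.
  else oneLe (descent stepTerm (j / 2 + 2))

section

variable {C : Type u} [CRL C] [IsGodelChain C] (v : ℕ → KExp C)

theorem eval_inf_one_eq_one_iff {t : Term} :
    (inf t one).eval v = one.eval v ↔ (t.eval v).fst = 1 := by
  rw [KExp.ext_iff]
  simp [eval, IsIntegral.le_one]

/-- In a chain a join is `1` only if a joinand is, so joins of terms express disjunctions. -/
theorem fst_eval_descent (b : Term) (n : ℕ) : ((descent b n).eval v).fst = 1 ↔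
    (b.eval v).fst = 1 ∨ ∃ i < n, (v i).fst ≤ (v (i + 1)).fst := by
  induction n with
  | zero => simp [descent]
  | succ n ih =>
    have h : ((descent b (n + 1)).eval v).fst =
        ((descent b n).eval v).fst ⊔ ((v n).fst ⇨ (v (n + 1)).fst) := by
      simp [descent, eval, IsIntegral.le_one, imp_one]
    rw [h, IsGodelChain.sup_eq_one_iff, ih, CRL.imp_eq_one_iff, or_assoc, Nat.exists_lt_succ_right]

theorem fst_eval_stepTerm : (stepTerm.eval v).fst = 1 ↔ (v 0).fst ≤ (v 1).fst := by
  have h : (stepTerm.eval v).fst = ((v 0).fst ⇨ (v 1).fst) := by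
    simp [stepTerm, eval, IsIntegral.le_one, imp_one]
  rw [h, CRL.imp_eq_one_iff]

theorem fst_eval_exceedTerm (x y : ℕ) : ((exceedTerm x y).eval v).fst = 1 ↔
    ((v y).fst ⊔ (v y).snd ≤ (v x).fst → (v x).fst = 1) := by
  have h : ((exceedTerm x y).eval v).fst =
      (((v y).fst ⊔ (v y).snd) ⇨ (v x).fst) ⇨ (v x).fst := by
    simp [exceedTerm, eval, IsIntegral.le_one, imp_one, one_imp]
  -- In a Gödel chain `(p → x) → x` is `x` if `p ≤ x` and `1` otherwise.
  rw [h]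
  by_cases hle : (v y).fst ⊔ (v y).snd ≤ (v x).fst
  · rw [IsGodelChain.imp_of_le hle, one_imp]
    simp [hle]
  · rw [IsGodelChain.imp_of_not_le hle, IsGodelChain.imp_of_le le_rfl]
    simp [hle]

end

end Term

theorem mem_models_iff_of_injective {B : Type u} {C : Type v} [CRL B] [CRL C] [IsGodelChain C]
    (f : CRLHom B (KExp C)) (hf : Function.Injective f.toFun) (t : Term) :
    CRLAlg.mk B ∈ models (Term.oneLe t) ↔
      ∀ v : ℕ → B, (t.eval fun n => f.toFun (v n)).fst = 1 := by
  simp only [models, Term.oneLe, Set.mem_ofPred_eq, Set.mem_singleton_iff, forall_eq]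
  refine forall_congr' fun v => ?_
  rw [← Term.eval_inf_one_eq_one_iff, ← f.map_eval, ← f.map_eval, hf.eq_iff]

theorem mem_models_kExp_iff {C : Type u} [CRL C] [IsGodelChain C] (t : Term) :
    CRLAlg.mk (KExp C) ∈ models (Term.oneLe t) ↔ ∀ v : ℕ → KExp C, (t.eval v).fst = 1 := by
  simp only [← Term.eval_inf_one_eq_one_iff]
  simp [models, Term.oneLe]

theorem val_add_le_of_descending {m n : ℕ} {a : ℕ → GodelChain.{u} (m + 2)}
    (h : ∀ i < n, a (i + 1) < a i) : ∀ i ≤ n, (a i).val.val + i ≤ m + 1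
  | 0, _ => by have := (a 0).val.isLt; omega
  | i + 1, hi => by
    have h1 : (a (i + 1)).val.val < (a i).val.val := h i hi
    have h2 := val_add_le_of_descending h i (by omega)
    omega

theorem kAlg_mem_models_separator (j : ℕ) : kAlg.{u} j ∈ models (Term.separator j) := by
  obtain ⟨m, rfl | rfl⟩ := even_or_odd_index j
  · rw [kAlg_even, Term.separator, if_pos (by omega), show 2 * m / 2 = m by omega]
    let := (puncture_isSubuniverse.{u} m).crl
    refine (mem_models_iff_of_injective (puncture_isSubuniverse m).incl
      Subtype.val_injective _).2 fun v => ?_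
    rw [Term.fst_eval_descent, or_iff_not_imp_right]
    intro h
    push Not at h
    rw [Term.fst_eval_exceedTerm]
    intro hle
    have h0 : (v (m + 1)).val.fst = ⊥ := GodelChain.ext (Fin.ext (by
      have h1 := val_add_le_of_descending (a := fun i => (v i).val.fst) h (m + 1) le_rfl
      have h2 : (v (m + 1)).val.fst.val.val = 0 := by omega
      exact h2))
    have hle' : (v (m + 2)).val.fst ⊔ (v (m + 2)).val.snd ≤ (v (m + 1)).val.fst := hle
    rw [h0, le_bot_iff, sup_eq_bot_iff] at hle'
    exact absurd (KExp.ext hle'.1 hle'.2) (v (m + 2)).2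
  · rw [kAlg_odd, Term.separator, if_neg (by omega), show (2 * m + 1) / 2 = m by omega]
    refine (mem_models_kExp_iff _).2 fun v => ?_
    rw [Term.fst_eval_descent]
    refine Or.inr ?_
    by_contra! h
    have := val_add_le_of_descending (a := fun i => (v i).fst) h (m + 2) le_rfl
    omega

theorem kAlg_succ_notMem_models_separator (j : ℕ) :
    kAlg.{u} (j + 1) ∉ models (Term.separator j) := by
  obtain ⟨m, rfl | rfl⟩ := even_or_odd_index j
  · rw [kAlg_odd, Term.separator, if_pos (by omega), show 2 * m / 2 = m by omega]
    intro h
    -- The first coordinates run down the whole chain; truncated subtraction makes the value at `m +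
    -- 2` the point `(⊥, ⊥)`, absent from the punctured algebra.
    let v : ℕ → KExp (GodelChain.{u} (m + 2)) := fun i =>
      ⟨⟨⟨m + 1 - i, by omega⟩⟩, ⟨⟨0, by omega⟩⟩⟩
    have h1 := (mem_models_kExp_iff _).1 h v
    rw [Term.fst_eval_descent, Term.fst_eval_exceedTerm] at h1
    rcases h1 with h1 | ⟨i, hi, h1⟩
    · have h2 : (v (m + 1)).fst = 1 := h1 (by
        have h3 : (v (m + 2)).fst = (v (m + 1)).fst :=
          GodelChain.ext (Fin.ext (show m + 1 - (m + 2) = m + 1 - (m + 1) by omega))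
        have h4 : (v (m + 2)).snd = (v (m + 1)).fst :=
          GodelChain.ext (Fin.ext (show 0 = m + 1 - (m + 1) by omega))
        rw [h3, h4, sup_idem])
      have h3 : m + 1 - (m + 1) = m + 2 - (0 + 1) := congrArg (fun x => x.val.val) h2
      omega
    · have h2 : m + 1 - i ≤ m + 1 - (i + 1) := h1
      omega
  · rw [show 2 * m + 1 + 1 = 2 * (m + 1) by ring, kAlg_even, Term.separator, if_neg (by omega),
      show (2 * m + 1) / 2 = m by omega]
    let := (puncture_isSubuniverse.{u} (m + 1)).crl
    intro h
    have h := (mem_models_iff_of_injective (puncture_isSubuniverse (m + 1)).incl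
      Subtype.val_injective _).1 h
    -- A descent through all `m + 3` elements; the second coordinate `⊤` keeps it inside the
    -- punctured algebra.
    have h1 := h fun i => ⟨⟨⟨⟨m + 2 - i, by omega⟩⟩, ⊤⟩,
      fun h => top_ne_bot (congrArg KExp.snd h)⟩
    rw [Term.fst_eval_descent, Term.fst_eval_stepTerm] at h1
    rcases h1 with h1 | ⟨i, hi, h1⟩
    · have h2 : m + 2 - 0 ≤ m + 2 - 1 := h1
      omega
    · have h2 : m + 2 - i ≤ m + 2 - (i + 1) := h1
      omega

/-! ### Strictness of the chain and its order type -/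

theorem not_subsingleton_kAlg_zero : ¬ Subsingleton (kAlg.{u} 0) := by
  rw [show (0 : ℕ) = 2 * 0 from rfl, kAlg_even]
  intro (h : Subsingleton (puncture.{u} 2))
  have h1 : (⟨⊤, ⊤⟩ : KExp (GodelChain.{u} 2)) ∈ puncture 2 :=
    fun h => top_ne_bot (congrArg KExp.fst h)
  have h2 : (⟨⊤, ⊥⟩ : KExp (GodelChain.{u} 2)) ∈ puncture 2 :=
    fun h => top_ne_bot (congrArg KExp.fst h)
  have h3 : (⟨_, h1⟩ : puncture.{u} 2) = ⟨_, h2⟩ := Subsingleton.elim _ _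
  exact top_ne_bot (congrArg (fun x => x.val.snd) h3)

/-- If `j ≥ n`, then membership would pass down to `kAlg n`, which fails the identity separating it
from its predecessor, or is nontrivial when `n = 0`. -/
theorem kAlg_mem_kVariety_iff {j n : ℕ} : kAlg.{u} j ∈ kVariety n ↔ j < n := by
  constructor
  · intro h
    by_contra! hnj
    have h := (isVariety_kVariety n).kAlg_mem_of_le hnj h
    cases n with
    | zero => exact not_subsingleton_kAlg_zero h
    | succ n =>
      exact kAlg_succ_notMem_models_separator n
        ((varietyGen_singleton_subset_iff (isVariety_models _)).2 (kAlg_mem_models_separator n) h)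
  · intro h
    cases n with
    | zero => exact absurd h (Nat.not_lt_zero j)
    | succ n =>
      exact (isVariety_varietyGen _).kAlg_mem_of_le (Nat.le_of_lt_succ h) (subset_varietyGen _ rfl)

theorem kVariety_subset_kVariety_iff {m n : ℕ} : kVariety.{u} m ⊆ kVariety n ↔ m ≤ n := by
  refine ⟨fun h => ?_, fun h => kVariety_subset (isVariety_kVariety n)
    fun j hj => kAlg_mem_kVariety_iff.2 (hj.trans_le h)⟩
  cases m with
  | zero => exact Nat.zero_le n
  | succ j => exact kAlg_mem_kVariety_iff.1 (h (kAlg_mem_kVariety_iff.2 (Nat.lt_succ_self j)))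

theorem kVariety_ssubset_GNPcL (n : ℕ) : kVariety.{u} n ⊂ GNPcL :=
  ⟨kVariety_subset isVariety_GNPcL fun j _ => kAlg_mem_GNPcL j,
    fun h => lt_irrefl n (kAlg_mem_kVariety_iff.1 (h (kAlg_mem_GNPcL n)))⟩

/-- The enumeration of the subvarieties of `GNPcL` in type `ω + 1`. -/
def subvarietyOf : WithTop ℕ → Subvarieties GNPcL.{u}
  | ⊤ => ⟨GNPcL, isVariety_GNPcL, subset_rfl⟩
  | (n : ℕ) => ⟨kVariety n, isVariety_kVariety n, (kVariety_ssubset_GNPcL n).subset⟩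

theorem subvarietyOf_le_iff {a b : WithTop ℕ} :
    subvarietyOf.{u} a ≤ subvarietyOf b ↔ a ≤ b := by
  induction a with
  | top =>
    induction b with
    | top => exact iff_of_true le_rfl le_rfl
    | coe n => exact iff_of_false (kVariety_ssubset_GNPcL n).not_subset (by simp)
  | coe m =>
    induction b with
    | top => exact iff_of_true (kVariety_ssubset_GNPcL m).subset le_top
    | coe n => exact kVariety_subset_kVariety_iff.trans WithTop.coe_le_coe.symm

theorem subvarietyOf_surjective : Function.Surjective subvarietyOf.{u} := by
  rintro ⟨W, hW, hWG⟩
  rcases eq_GNPcL_or_eq_kVariety hW hWG with rfl | ⟨n, rfl⟩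
  · exact ⟨⊤, rfl⟩
  · exact ⟨(n : ℕ), rfl⟩

theorem nonempty_subvarieties_orderIso : Nonempty (Subvarieties GNPcL.{u} ≃o WithTop ℕ) :=
  ⟨(RelIso.ofSurjective (OrderEmbedding.ofMapLEIff subvarietyOf fun _ _ => subvarietyOf_le_iff)
    subvarietyOf_surjective).symm⟩

end KLattice

theorem mainTheorem7 :
    -- `GNPcL` is a variety, and it equals `K(GH)`
    (IsVariety GNPcL.{u} ∧ GNPcL.{u} = KClass GH.{u}) ∧
    -- `V(K_{n²}) = K(V(G_n))` for `n = m + 2 ≥ 2`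
    (∀ m : ℕ, varietyGen {algKSq.{u} (m + 2)} = KClass (varietyGen {algG.{u} (m + 2)})) ∧
    -- the lattice of subvarieties of `GNPcL` is a chain of type `ω + 1`
    Nonempty (Subvarieties GNPcL.{u} ≃o WithTop ℕ) ∧
    -- its proper members are the trivial variety, the `V(K_{n²})` and the `V(K_{n²-1})`, `n ≥ 2`
    (∀ W : Set CRLAlg.{u}, (IsVariety W ∧ W ⊂ GNPcL.{u}) ↔
      (W = trivialVariety ∨ ∃ k A, IsK k A ∧ W = varietyGen {A})) ∧
    -- and the latter are ordered by their index
    (∀ (k l : ℕ) (A B : CRLAlg.{u}), IsK k A → IsK l B →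
      (varietyGen {A} ⊆ varietyGen {B} ↔ k ≤ l)) := by
  refine ⟨⟨isVariety_GNPcL, GNPcL_eq_KClass_GH⟩, fun m => varietyGen_kExp _,
    nonempty_subvarieties_orderIso, fun W => ⟨?_, ?_⟩, fun k l A B hA hB => ?_⟩
  · rintro ⟨hW, hWG⟩
    rcases eq_GNPcL_or_eq_kVariety hW hWG.subset with rfl | ⟨_ | j, rfl⟩
    · exact absurd rfl hWG.ne
    · exact Or.inl rfl
    · exact Or.inr ⟨_, _, isK_iff.2 ⟨j, rfl, rfl⟩, rfl⟩
  · rintro (rfl | ⟨k, A, hA, rfl⟩)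
    · exact ⟨isVariety_kVariety 0, kVariety_ssubset_GNPcL 0⟩
    · obtain ⟨j, -, rfl⟩ := isK_iff.1 hA
      exact ⟨isVariety_kVariety (j + 1), kVariety_ssubset_GNPcL (j + 1)⟩
  · obtain ⟨i, rfl, rfl⟩ := isK_iff.1 hA
    obtain ⟨j, rfl, rfl⟩ := isK_iff.1 hB
    rw [strictMono_kIndex.le_iff_le, ← Nat.add_le_add_iff_right (n := 1)]
    exact kVariety_subset_kVariety_iff (m := i + 1) (n := j + 1)
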